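/- For $p\in(0,1)$ let $c_p\in\mathbb R$ be the unique real number with $\mathbb P[Z\le -c_p]=p$, where $Z\sim\mathcal N(0,1)$, and put $a=\frac{1}{\sqrt{2\pi}}e^{-c_p^2/2}$. Let $x_1,\dots,x_r$ be independent $\mathcal N(0,\frac1d I_d)$ vectors in $\mathbb R^d$. They form a red clique if $\langle x_i,x_j\rangle<-c_p/\sqrt d$ for all $i\ne j$, and a blue clique if $\langle x_i,x_j\rangle\ge -c_p/\sqrt d$ for all $i\neq j$. Given $C>1$ and $\ell$, put $\alpha=100\,C\log(10/p)$ and $\delta=\alpha d^{-1/4}$, and call $(x_1,\dots,x_r)$ a perfect sequence if, for every $1\le i\le r$, $\|x_i\|_2\in(1-\delta,1+\delta)$ and the orthogonal projection of $x_i$ onto $\mathrm{span}\{x_1,\dots,x_{i-1}\}$ has norm at most $\alpha\sqrt{\ell}/\sqrt{d}$. Let $P^*_{\mathrm{red},r}$ (respectively $P^*_{\mathrm{blue},r}$) be the probability that $x_1,\dots,x_r$ form a red (respectively blue) clique and a perfect sequence. For all real $C>1$ and $p\in(0,1)$ there are constants $K>0$ and $D_0>0$, depending only on $p$ and $C$,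 such that for every real $D\ge D_0$ there is $\ell_0$ such that for all integers $\ell\ge\ell_0$ for which $d=D^2\ell^2$ is an integer, and for every integer $r$ with $1\le r\le C\ell$ and $r\neq 2$, $$P^*_{\mathrm{red},r}\le p^{\binom r2}\exp\Big(-\Big(1-\frac KD\Big)\frac{a^3}{p^3\sqrt d}\binom r3\Big),\qquad P^*_{\mathrm{blue},r}\le (1-p)^{\binom r2}\exp\Big(\Big(1+\frac KD\Big)\frac{a^3}{(1-p)^3\sqrt d}\binom r3\Big),$$ while for $r=2$ (provided $2\le C\ell$) $$P^*_{\mathrm{red},2}\le p\,\exp\Big(\frac{K}{D\sqrt d}\Big),\qquad P^*_{\mathrm{blue},2}\le (1-p)\exp\Big(\frac{K}{D\sqrt d}\Big).$$ -/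

import Mathlib

open MeasureTheory ProbabilityTheory
open scoped RealInnerProductSpace

noncomputable section

/-- The threshold `c_p`: the real number `c` with `ℙ[Z ≤ -c] = p` for a standard Gaussian `Z`.
For `0 < p < 1` it exists and is unique, see `gaussThreshold_spec`, `gaussThreshold_unique`. -/
def gaussThreshold (p : ℝ) : ℝ :=
  Classical.epsilon fun c : ℝ => (gaussianReal 0 1).real (Set.Iic (-c)) = p

theorem gaussThreshold_spec {p : ℝ} (hp0 : 0 < p) (hp1 : p < 1) :
    (gaussianReal 0 1).real (Set.Iic (-gaussThreshold p)) = p := by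
  have : NullSingletonClass (gaussianReal 0 1) := nullSingletonClass_gaussianReal one_ne_zero
  have hcont : Continuous (cdf (gaussianReal 0 1)) := by
    rw [continuous_iff_continuousAt]
    intro x
    rw [(monotone_cdf _).continuousAt_iff_leftLim_eq_rightLim, StieltjesFunction.rightLim_eq]
    refine le_antisymm ((monotone_cdf _).leftLim_le le_rfl) ?_
    have h : (gaussianReal 0 1) {x} = 0 := measure_singleton x
    rw [← measure_cdf (gaussianReal 0 1), StieltjesFunction.measure_singleton,
      ENNReal.ofReal_eq_zero] at h
    linarith
  obtain ⟨x, hx⟩ : ∃ x, cdf (gaussianReal 0 1) x = p := by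
    refine mem_range_of_exists_le_of_exists_ge hcont ?_ ?_
    · exact ((tendsto_cdf_atBot (gaussianReal 0 1)).eventually (ge_mem_nhds hp0)).exists
    · exact ((tendsto_cdf_atTop (gaussianReal 0 1)).eventually (le_mem_nhds hp1)).exists
  rw [cdf_eq_real] at hx
  exact Classical.epsilon_spec
    (p := fun c : ℝ => (gaussianReal 0 1).real (Set.Iic (-c)) = p) ⟨-x, by simpa using hx⟩

theorem gaussThreshold_unique {p c : ℝ} (hp0 : 0 < p) (hp1 : p < 1)
    (hc : (gaussianReal 0 1).real (Set.Iic (-c)) = p) : c = gaussThreshold p := by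
  have key : ∀ x y : ℝ, x < y →
      (gaussianReal 0 1).real (Set.Iic x) ≠ (gaussianReal 0 1).real (Set.Iic y) := by
    intro x y hxy h
    have h1 : (gaussianReal 0 1).real (Set.Ioc x y) = 0 := by
      rw [← Set.Iic_sdiff_Iic, measureReal_sdiff (Set.Iic_subset_Iic.2 hxy.le) measurableSet_Iic, h,
        sub_self]
    have h2 : (gaussianReal 0 1) (Set.Ioc x y) = 0 := by
      rwa [measureReal_eq_zero_iff] at h1
    have h3 := gaussianReal_absolutelyContinuous' 0 (one_ne_zero (α := NNReal)) h2
    rw [Real.volume_Ioc, ENNReal.ofReal_eq_zero] at h3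
    linarith
  have hs := gaussThreshold_spec hp0 hp1
  rcases lt_trichotomy c (gaussThreshold p) with h | h | h
  · exact absurd (hs.trans hc.symm) (key _ _ (by linarith))
  · exact h
  · exact absurd (hc.trans hs.symm) (key _ _ (by linarith))

/-- `a = φ(c_p) = exp(-c_p² / 2) / √(2π)`. -/
def gaussDensityAtThreshold (p : ℝ) : ℝ :=
  Real.exp (-(gaussThreshold p) ^ 2 / 2) / √(2 * Real.pi)

/-- The joint law of `r` independent random vectors `x₁, …, x_r ∼ 𝒩(0, (1/d) I_d)` in `ℝ^d`. -/
def gaussSample (d r : ℕ) : Measure (Fin r → EuclideanSpace ℝ (Fin d)) :=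
  Measure.pi fun _ => multivariateGaussian 0 ((1 / (d : ℝ)) • (1 : Matrix (Fin d) (Fin d) ℝ))

/-- The geometric graph of the vectors `x₁, …, x_r`: distinct `i, j` are adjacent iff
`⟨x_i, x_j⟩ ≥ -c_p / √d`. Its edges are the blue edges, its non-edges the red ones. -/
def geomGraph (p : ℝ) {d r : ℕ} (x : Fin r → EuclideanSpace ℝ (Fin d)) : SimpleGraph (Fin r) where
  Adj i j := i ≠ j ∧ -gaussThreshold p / √(d : ℝ) ≤ ⟪x i, x j⟫
  symm := ⟨fun i j h => ⟨h.1.symm, by rw [real_inner_comm]; exact h.2⟩⟩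
  loopless := ⟨fun _ h => h.1 rfl⟩

/-- The vectors form a red clique: no two of them are adjacent. -/
def IsRedClique (p : ℝ) {d r : ℕ} (x : Fin r → EuclideanSpace ℝ (Fin d)) : Prop :=
  (geomGraph p x).IsIndepSet Set.univ

/-- The vectors form a blue clique: any two of them are adjacent. -/
def IsBlueClique (p : ℝ) {d r : ℕ} (x : Fin r → EuclideanSpace ℝ (Fin d)) : Prop :=
  (geomGraph p x).IsClique Set.univ

/-- `α = 100 C log (10 / p)`. -/
def perfectAlpha (C p : ℝ) : ℝ := 100 * C * Real.log (10 / p)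

/-- `δ = α d^(-1/4)`. -/
def perfectDelta (C p : ℝ) (d : ℕ) : ℝ := perfectAlpha C p * (d : ℝ) ^ (-(1 / 4) : ℝ)

/-- Perfect sequences: for every `i`, the norm of `x_i` lies in `(1 - δ, 1 + δ)` and the
orthogonal projection of `x_i` to the span of the earlier vectors has norm at most `α √ℓ / √d`. -/
def IsPerfectSeq (C p : ℝ) (ℓ : ℕ) {d r : ℕ} (x : Fin r → EuclideanSpace ℝ (Fin d)) : Prop :=
  ∀ i : Fin r,
    ‖x i‖ ∈ Set.Ioo (1 - perfectDelta C p d) (1 + perfectDelta C p d) ∧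
    ‖(Submodule.span ℝ (x '' {j | j < i})).starProjection (x i)‖ ≤
      perfectAlpha C p * √(ℓ : ℝ) / √(d : ℝ)

/-- `P*_{red, r}`: the probability that `r` independent vectors distributed as `𝒩(0, (1/d) I_d)`
form a red clique and a perfect sequence. -/
def redPerfectProb (C p : ℝ) (ℓ d r : ℕ) : ℝ :=
  (gaussSample d r).real {x | IsRedClique p x ∧ IsPerfectSeq C p ℓ x}

/-- `P*_{blue, r}`: the probability that `r` independent vectors distributed as `𝒩(0, (1/d) I_d)`
form a blue clique and a perfect sequence. -/
def bluePerfectProb (C p : ℝ) (ℓ d r : ℕ) : ℝ :=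
  (gaussSample d r).real {x | IsBlueClique p x ∧ IsPerfectSeq C p ℓ x}

end

/-! ### The standard Gaussian distribution function -/

/-! The vectors are integrated out one at a time, the last one first. Put w = 1/√d. With x_1, …, x_k
fixed, the next vector g must satisfy σ⟨x_i, g⟩ ≤ -c w for all i; red is σ = 1, and blue is σ = -1
with c replaced by -c, so one argument serves both colours. Log-concavity of the Gaussian
distribution function Φ gives Φ(u) ≤ q exp(h(u + c)) with q = Φ(-c) and h = φ(c)/q
(`gaussianReal_real_Iic_le_tangent`). Applied successively along the Gram–Schmidt residuals of the
x_i, completing the square each time, this bounds the orthant probability by q^k times the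
exponential of about h² ∑_{i<j} ⟨x_i, x_j⟩ plus threshold corrections (`stdGaussian_orthant_le`).

Hence each integration leaves an extra weight exp(h² · `pairSum`) on the remaining vectors; after n
of them the weight is exp(lam · `pairSum`) with lam ≈ n h². For the next vector this is a linear
tilt along lam ∑ x_i. It moves each of the k thresholds by about σ lam w and so contributes exp(-σ h
lam w k) ≈ exp(-σ h³ w n k). Summing n k over n + k = r - 1 gives C(r,3), which is the main term,
with h = a/p or h = a/(1-p).

Perfectness keeps norms and residual lengths near 1, and two kinds of error need care. Norm
fluctuations enter linearly through ‖g‖² - 1, too large in absolute value but of mean zero; they are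
carried along in the exponent (`normPotential`) and integrated by a change of variance. Errors in
|⟨x_i, x_j⟩| are turned, by the one-sided clique condition, into multiples of `pairSum` and absorbed
in the tilt (`sum_sum_abs_inner_le`, `nextTilt`). Each step then loses O(r² w / D) in the exponent
(`lintegral_step_le`), in total O(r³ / (D√d)). For r ≥ 3 this is a relative error O(1/D) of the main
term; for r = 2 the main term vanishes and the error stands alone. -/

theorem gaussianReal_real_Iic (x : ℝ) :
    (gaussianReal 0 1).real (Set.Iic x) = ∫ t in Set.Iic x, gaussianPDFReal 0 1 t := by
  rw [measureReal_def, gaussianReal_apply_eq_integral 0 one_ne_zero, ENNReal.toReal_ofReal]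
  exact integral_nonneg fun t => gaussianPDFReal_nonneg _ _ _

theorem continuous_gaussianPDFReal_zero_one : Continuous (gaussianPDFReal 0 1) := by
  rw [gaussianPDFReal_def]
  fun_prop

theorem hasDerivAt_gaussianReal_real_Iic (x : ℝ) :
    HasDerivAt (fun y => (gaussianReal 0 1).real (Set.Iic y)) (gaussianPDFReal 0 1 x) x := by
  have hint := integrable_gaussianPDFReal 0 1
  have h : ∀ y, (gaussianReal 0 1).real (Set.Iic y) =
      (∫ t in (0 : ℝ)..y, gaussianPDFReal 0 1 t) + (gaussianReal 0 1).real (Set.Iic 0) := by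
    intro y
    rw [gaussianReal_real_Iic, gaussianReal_real_Iic,
      ← intervalIntegral.integral_Iic_sub_Iic hint.integrableOn hint.integrableOn]
    ring
  rw [funext h]
  exact (intervalIntegral.integral_hasDerivAt_right hint.intervalIntegrable
    (continuous_gaussianPDFReal_zero_one.stronglyMeasurableAtFilter _ _)
    continuous_gaussianPDFReal_zero_one.continuousAt).add_const _

theorem hasDerivAt_gaussianPDFReal_zero_one (x : ℝ) :
    HasDerivAt (gaussianPDFReal 0 1) (-x * gaussianPDFReal 0 1 x) x := by
  have h1 : HasDerivAt (fun y : ℝ => -(y - 0) ^ 2 / (2 * ((1 : NNReal) : ℝ))) (-x) x := by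
    have := ((((hasDerivAt_id x).sub_const 0).pow 2).neg).div_const (2 * ((1 : NNReal) : ℝ))
    refine this.congr_deriv ?_
    simp
    ring
  have := (h1.exp).const_mul (√(2 * Real.pi * ((1 : NNReal) : ℝ)))⁻¹
  rw [gaussianPDFReal_def]
  refine this.congr_deriv ?_
  ring

theorem gaussianReal_real_Iic_pos (x : ℝ) : 0 < (gaussianReal 0 1).real (Set.Iic x) := by
  rw [measureReal_def]
  refine ENNReal.toReal_pos (fun h => ?_) (measure_ne_top _ _)
  have := gaussianReal_absolutelyContinuous' 0 (one_ne_zero (α := NNReal)) h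
  simp at this

theorem tendsto_gaussianPDFReal_atBot :
    Filter.Tendsto (gaussianPDFReal 0 1) Filter.atBot (nhds 0) := by
  rw [gaussianPDFReal_def]
  have h : Filter.Tendsto (fun x : ℝ => -(x - 0) ^ 2 / (2 * ((1 : NNReal) : ℝ)))
      Filter.atBot Filter.atBot := by
    have h2 : Filter.Tendsto (fun x : ℝ => x * x) Filter.atBot Filter.atTop :=
      Filter.tendsto_id.atBot_mul_atBot₀ Filter.tendsto_id
    have h3 := (h2.const_mul_atTop (show (0 : ℝ) < 1 / 2 by norm_num))
    refine (Filter.tendsto_neg_atTop_atBot.comp h3).congr fun x => ?_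
    simp only [Function.comp, NNReal.coe_one]
    ring
  simpa using (Real.tendsto_exp_atBot.comp h).const_mul (√(2 * Real.pi * ((1 : NNReal) : ℝ)))⁻¹

theorem integrable_mul_gaussianPDFReal :
    Integrable (fun t => -t * gaussianPDFReal 0 1 t) := by
  have h := integrable_mul_exp_neg_mul_sq (b := 1 / 2) (by norm_num)
  refine (h.const_mul (-(√(2 * Real.pi * ((1 : NNReal) : ℝ)))⁻¹)).congr (ae_of_all _ fun x => ?_)
  simp only [gaussianPDFReal_def, NNReal.coe_one]
  ring_nf

/-- The Mills-ratio inequality `x Φ(x) + φ(x) ≥ 0`. -/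
theorem mul_gaussianReal_real_Iic_add_pdf_nonneg (x : ℝ) :
    0 ≤ x * (gaussianReal 0 1).real (Set.Iic x) + gaussianPDFReal 0 1 x := by
  -- Since φ' = -tφ, the quantity equals ∫_{t ≤ x} (x - t) φ(t) dt, whose integrand is nonnegative.
  have h1 : ∫ t in Set.Iic x, -t * gaussianPDFReal 0 1 t = gaussianPDFReal 0 1 x - 0 :=
    integral_Iic_of_hasDerivAt_of_tendsto
      continuous_gaussianPDFReal_zero_one.continuousWithinAt
      (fun t _ => hasDerivAt_gaussianPDFReal_zero_one t)
      integrable_mul_gaussianPDFReal.integrableOn tendsto_gaussianPDFReal_atBot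
  rw [gaussianReal_real_Iic, ← integral_const_mul, ← sub_zero (gaussianPDFReal 0 1 x), ← h1,
    ← integral_add ((integrable_gaussianPDFReal 0 1).const_mul x).integrableOn
      integrable_mul_gaussianPDFReal.integrableOn]
  refine setIntegral_nonneg measurableSet_Iic fun t ht => ?_
  have := gaussianPDFReal_nonneg 0 1 t
  have h2 : t ≤ x := ht
  nlinarith

/-- The derivative of φ/Φ is -φ (xΦ + φ)/Φ². As φ/Φ = (log Φ)', this is the log-concavity of Φ. -/
theorem antitone_gaussian_mills :
    Antitone fun x => gaussianPDFReal 0 1 x / (gaussianReal 0 1).real (Set.Iic x) := by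
  refine antitone_of_hasDerivAt_nonpos (fun x => (hasDerivAt_gaussianPDFReal_zero_one x).div
    (hasDerivAt_gaussianReal_real_Iic x) (gaussianReal_real_Iic_pos x).ne') fun x => ?_
  have h1 := mul_gaussianReal_real_Iic_add_pdf_nonneg x
  have h2 := gaussianPDFReal_nonneg 0 1 x
  refine div_nonpos_of_nonpos_of_nonneg ?_ (sq_nonneg _)
  nlinarith [mul_nonneg h1 h2]

/-- Log-concavity of the Gaussian distribution function, as a tangent-line bound. -/
theorem gaussianReal_real_Iic_le_tangent (x y : ℝ) :
    (gaussianReal 0 1).real (Set.Iic y) ≤ (gaussianReal 0 1).real (Set.Iic x) *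
      Real.exp (gaussianPDFReal 0 1 x / (gaussianReal 0 1).real (Set.Iic x) * (y - x)) := by
  set Φ : ℝ → ℝ := fun y => (gaussianReal 0 1).real (Set.Iic y) with hΦ
  set h := gaussianPDFReal 0 1 x / Φ x with hh
  have hpos : ∀ z, 0 < Φ z := gaussianReal_real_Iic_pos
  -- The logarithmic derivative of f is φ/Φ - h, which passes from nonnegative to nonpositive at x;
  -- so f is maximal at x.
  set f : ℝ → ℝ := fun z => Φ z * Real.exp (-h * (z - x)) with hf
  have hd : ∀ z, HasDerivAt f
      (Φ z * Real.exp (-h * (z - x)) * (gaussianPDFReal 0 1 z / Φ z - h)) z := by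
    intro z
    have h1 : HasDerivAt (fun z => -h * (z - x)) (-h) z := by
      simpa using ((hasDerivAt_id z).sub_const x).const_mul (-h)
    refine ((hasDerivAt_gaussianReal_real_Iic z).mul h1.exp).congr_deriv ?_
    have := (hpos z).ne'
    field_simp
    ring
  have key : f y ≤ f x := by
    have hc : Continuous f := continuous_iff_continuousAt.2 fun z => (hd z).continuousAt
    rcases le_total y x with hyx | hxy
    · refine monotoneOn_of_hasDerivWithinAt_nonneg (convex_Iic x) hc.continuousOn
        (fun z _ => (hd z).hasDerivWithinAt) (fun z hz => ?_) hyx Set.self_mem_Iic hyx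
      rw [interior_Iic] at hz
      have := antitone_gaussian_mills (show z ≤ x from le_of_lt hz)
      exact mul_nonneg (mul_pos (hpos z) (Real.exp_pos _)).le (sub_nonneg.2 this)
    · refine antitoneOn_of_hasDerivWithinAt_nonpos (convex_Ici x) hc.continuousOn
        (fun z _ => (hd z).hasDerivWithinAt) (fun z hz => ?_) Set.self_mem_Ici hxy hxy
      rw [interior_Ici] at hz
      have := antitone_gaussian_mills (show x ≤ z from le_of_lt hz)
      exact mul_nonpos_of_nonneg_of_nonpos (mul_pos (hpos z) (Real.exp_pos _)).le
        (sub_nonpos.2 this)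
  have h0 : f x = Φ x := by simp [hf]
  calc Φ y = f y * Real.exp (h * (y - x)) := by
        simp only [hf]
        rw [mul_assoc, ← Real.exp_add]
        simp
    _ ≤ Φ x * Real.exp (h * (y - x)) := by
        rw [← h0]
        exact mul_le_mul_of_nonneg_right key (Real.exp_pos _).le

/-! ### The standard Gaussian measure on a Euclidean space -/

section StdGaussian

variable {E : Type*} [NormedAddCommGroup E] [InnerProductSpace ℝ E] [FiniteDimensional ℝ E]
  [MeasurableSpace E] [BorelSpace E]

/-- Replacing the component of a standard Gaussian vector along a unit vector by an independent
standard Gaussian does not change its law. -/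
theorem stdGaussian_map_resample {u : E} (hu : ‖u‖ = 1) :
    ((stdGaussian E).prod (gaussianReal 0 1)).map (fun z : E × ℝ => z.1 - ⟪u, z.1⟫ • u + z.2 • u) =
      stdGaussian E := by
  have hm : Measurable (fun z : E × ℝ => z.1 - ⟪u, z.1⟫ • u + z.2 • u) :=
    Continuous.measurable (by fun_prop)
  have : IsProbabilityMeasure (((stdGaussian E).prod (gaussianReal 0 1)).map
      (fun z : E × ℝ => z.1 - ⟪u, z.1⟫ • u + z.2 • u)) :=
    Measure.isProbabilityMeasure_map hm.aemeasurable
  refine Measure.ext_of_charFun (funext fun t => ?_)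
  rw [charFun_apply, integral_map hm.aemeasurable (Continuous.aestronglyMeasurable (by fun_prop))]
  -- Self-adjointness moves the projection off u onto t, so the characteristic function factors;
  -- Pythagoras for t then recombines the two Gaussian factors.
  have h : ∀ z : E × ℝ, Complex.exp (⟪z.1 - ⟪u, z.1⟫ • u + z.2 • u, t⟫ * Complex.I) =
      Complex.exp (⟪z.1, t - ⟪u, t⟫ • u⟫ * Complex.I) *
        Complex.exp (⟪u, t⟫ * z.2 * Complex.I) := by
    intro z
    rw [← Complex.exp_add]
    congr 1
    rw [← add_mul]
    congr 1
    simp only [inner_add_left, inner_sub_left, inner_sub_right, real_inner_smul_left,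
      real_inner_smul_right, real_inner_comm u z.1]
    push_cast
    ring
  simp_rw [h]
  rw [integral_prod_mul (μ := stdGaussian E) (ν := gaussianReal 0 1)
    (fun x => Complex.exp (⟪x, t - ⟪u, t⟫ • u⟫ * Complex.I))
    (fun ξ => Complex.exp (⟪u, t⟫ * ξ * Complex.I)), ← charFun_apply, ← charFun_apply_real,
    charFun_stdGaussian, charFun_gaussianReal, charFun_stdGaussian, ← Complex.exp_add]
  congr 1
  have h2 : ‖t - ⟪u, t⟫ • u‖ ^ 2 = ‖t‖ ^ 2 - ⟪u, t⟫ ^ 2 := by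
    rw [norm_sub_sq_real, norm_smul, hu, real_inner_smul_right, real_inner_comm u t]
    rw [Real.norm_eq_abs, mul_one, sq_abs]
    ring
  have h3 : ((‖t - ⟪u, t⟫ • u‖ : ℂ)) ^ 2 = (‖t‖ : ℂ) ^ 2 - (⟪u, t⟫ : ℂ) ^ 2 := by
    exact_mod_cast h2
  rw [h3]
  push_cast
  ring

theorem lintegral_stdGaussian_resample {u : E} (hu : ‖u‖ = 1) {F : E → ENNReal}
    (hF : Measurable F) :
    ∫⁻ g, F g ∂(stdGaussian E) =
      ∫⁻ g, ∫⁻ ξ, F (g - ⟪u, g⟫ • u + ξ • u) ∂(gaussianReal 0 1) ∂(stdGaussian E) := by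
  have hm : Measurable (fun z : E × ℝ => z.1 - ⟪u, z.1⟫ • u + z.2 • u) :=
    Continuous.measurable (by fun_prop)
  conv_lhs => rw [← stdGaussian_map_resample hu]
  rw [lintegral_map hF hm]
  exact lintegral_prod _ (hF.comp hm).aemeasurable

/-- Both sides are finite measures with the same characteristic function. The explicit density is
what permits the affine change of variables in `lintegral_stdGaussian_exp_quadratic_mul`. -/
theorem stdGaussian_eq_withDensity :
    stdGaussian E = (volume : Measure E).withDensity fun x =>
      ENNReal.ofReal ((2 * Real.pi) ^ (-(Module.finrank ℝ E : ℝ) / 2) *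
        Real.exp (-(1 / 2) * ‖x‖ ^ 2)) := by
  set n := Module.finrank ℝ E
  set K : ℝ := (2 * Real.pi) ^ (-(n : ℝ) / 2)
  have hK : 0 < K := Real.rpow_pos_of_pos (by positivity) _
  have hfin : Integrable (fun x : E => K * Real.exp (-(1 / 2) * ‖x‖ ^ 2)) := by
    have := (GaussianFourier.integrable_cexp_neg_mul_sq_norm_add (V := E) (b := 1 / 2)
      (by norm_num) 0 0).re.const_mul K
    refine this.congr (ae_of_all _ fun x => ?_)
    simp only [zero_mul, add_zero]
    rw [show (-(1 / 2 : ℂ) * (‖x‖ : ℂ) ^ 2) = ((-(1 / 2) * ‖x‖ ^ 2 : ℝ) : ℂ) by push_cast; ring,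
      ← Complex.ofReal_exp]
    rfl
  have : IsFiniteMeasure ((volume : Measure E).withDensity fun x =>
      ENNReal.ofReal (K * Real.exp (-(1 / 2) * ‖x‖ ^ 2))) :=
    isFiniteMeasure_withDensity_ofReal hfin.2
  refine Measure.ext_of_charFun (funext fun t => ?_)
  rw [charFun_stdGaussian, charFun_apply,
    integral_withDensity_eq_integral_toReal_smul (by fun_prop) (by simp)]
  have h : ∀ x : E, (ENNReal.ofReal (K * Real.exp (-(1 / 2) * ‖x‖ ^ 2))).toReal •
      Complex.exp (⟪x, t⟫ * Complex.I) =
      (K : ℂ) * Complex.exp (-(1 / 2 : ℂ) * (‖x‖ : ℂ) ^ 2 + Complex.I * (⟪t, x⟫ : ℂ)) := by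
    intro x
    rw [ENNReal.toReal_ofReal (by positivity), Complex.real_smul, Complex.exp_add,
      real_inner_comm, mul_comm Complex.I]
    push_cast
    ring
  simp_rw [h]
  rw [integral_const_mul, GaussianFourier.integral_cexp_neg_mul_sq_norm_add (by norm_num)]
  have h2 : (Real.pi / (1 / 2 : ℂ)) ^ ((n : ℂ) / 2) =
      (((2 * Real.pi) ^ ((n : ℝ) / 2) : ℝ) : ℂ) := by
    rw [Complex.ofReal_cpow (by positivity)]
    push_cast
    congr 1
    ring
  change _ = (K : ℂ) * ((Real.pi / (1 / 2 : ℂ)) ^ ((n : ℂ) / 2) * _)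
  rw [h2, ← mul_assoc, ← Complex.ofReal_mul]
  have h3 : K * (2 * Real.pi) ^ ((n : ℝ) / 2) = 1 := by
    simp only [K]
    rw [← Real.rpow_add (by positivity)]
    ring_nf
    simp
  rw [h3]
  simp
  ring_nf

/-- Completing the square for a standard Gaussian vector. -/
theorem lintegral_stdGaussian_exp_quadratic_mul {κ : ℝ} (hκ : 0 < κ) (v : E) {F : E → ENNReal}
    (hF : Measurable F) :
    ∫⁻ g, ENNReal.ofReal (Real.exp (⟪v, g⟫ + (1 - (κ ^ 2)⁻¹) / 2 * ‖g‖ ^ 2)) * F g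
        ∂(stdGaussian E) =
      ENNReal.ofReal (κ ^ Module.finrank ℝ E * Real.exp (κ ^ 2 * ‖v‖ ^ 2 / 2)) *
        ∫⁻ g, F (κ • g + κ ^ 2 • v) ∂(stdGaussian E) := by
  set n := Module.finrank ℝ E
  rw [stdGaussian_eq_withDensity]
  set K : ℝ := (2 * Real.pi) ^ (-(n : ℝ) / 2)
  have hK : 0 < K := Real.rpow_pos_of_pos (by positivity) _
  have hdens : Measurable fun x : E => ENNReal.ofReal (K * Real.exp (-(1 / 2) * ‖x‖ ^ 2)) := by
    fun_prop
  change ∫⁻ g, _ ∂(volume : Measure E).withDensity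
      (fun x => ENNReal.ofReal (K * Real.exp (-(1 / 2) * ‖x‖ ^ 2))) =
    _ * ∫⁻ g, _ ∂(volume : Measure E).withDensity
      (fun x => ENNReal.ofReal (K * Real.exp (-(1 / 2) * ‖x‖ ^ 2)))
  have hF2 : Measurable fun g : E => F (κ • g + κ ^ 2 • v) := by fun_prop
  rw [lintegral_withDensity_eq_lintegral_mul _ hdens (by fun_prop),
    lintegral_withDensity_eq_lintegral_mul _ hdens hF2]
  set G : E → ENNReal := fun x => ENNReal.ofReal (K * Real.exp (-(1 / 2) * ‖x‖ ^ 2) *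
    Real.exp (⟪v, x⟫ + (1 - (κ ^ 2)⁻¹) / 2 * ‖x‖ ^ 2)) * F x with hG
  have hGm : Measurable G := by fun_prop
  -- The total exponent is ⟨v, x⟩ - ‖x‖²/(2κ²); substituting κ y + κ² v for x turns it into κ²‖v‖²/2
  -- - ‖y‖²/2, with Jacobian κ^n.
  have h1 : ∫⁻ x : E, G x = ENNReal.ofReal (κ ^ n) * ∫⁻ x : E, G (κ • x + κ ^ 2 • v) := by
    rw [lintegral_add_right_eq_self (μ := (volume : Measure E)) G (κ ^ 2 • v) |>.symm]
    have h2 := Measure.map_addHaar_smul (volume : Measure E) hκ.ne'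
    have h3 : ∫⁻ x : E, G (κ • x + κ ^ 2 • v) =
        ENNReal.ofReal |(κ ^ n)⁻¹| * ∫⁻ x : E, G (x + κ ^ 2 • v) := by
      rw [← lintegral_map (f := fun y => G (y + κ ^ 2 • v)) (g := fun x : E => κ • x)
        (by fun_prop) (by fun_prop), h2, lintegral_smul_measure]
      rfl
    rw [h3, ← mul_assoc, ← ENNReal.ofReal_mul (by positivity), abs_of_pos (by positivity),
      mul_inv_cancel₀ (by positivity)]
    simp
  calc _ = ∫⁻ x : E, G x := by
        refine lintegral_congr fun x => ?_
        simp only [hG, Pi.mul_apply]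
        rw [← mul_assoc, ← ENNReal.ofReal_mul (by positivity)]
    _ = _ := by
        rw [h1, ENNReal.ofReal_mul (by positivity), mul_assoc]
        congr 1
        rw [← lintegral_const_mul _ (by fun_prop)]
        refine lintegral_congr fun x => ?_
        simp only [hG, Pi.mul_apply]
        rw [← mul_assoc, ← ENNReal.ofReal_mul (by positivity)]
        congr 2
        rw [mul_assoc, ← Real.exp_add, mul_left_comm, ← Real.exp_add]
        congr 2
        rw [norm_add_sq_real, norm_smul, norm_smul, inner_add_right, real_inner_smul_right,
          real_inner_smul_right, real_inner_smul_left, real_inner_smul_right,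
          real_inner_self_eq_norm_sq, real_inner_comm x v, Real.norm_eq_abs, Real.norm_eq_abs,
          mul_pow, mul_pow, sq_abs, sq_abs]
        field_simp
        ring

end StdGaussian

/-! ### Gaussian orthant probabilities -/

section Orthant

theorem measurableSet_orthant {E : Type*} [NormedAddCommGroup E] [InnerProductSpace ℝ E]
    [MeasurableSpace E] [BorelSpace E] {m : ℕ} (x : Fin m → E) (τ : Fin m → ℝ) :
    MeasurableSet {g : E | ∀ i, ⟪x i, g⟫ ≤ τ i} := by
  rw [Set.ofPred_forall]
  exact MeasurableSet.iInter fun i =>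
    (isClosed_le (by fun_prop) continuous_const).measurableSet

variable {E : Type*} [NormedAddCommGroup E] [InnerProductSpace ℝ E] [FiniteDimensional ℝ E]
  [MeasurableSpace E] [BorelSpace E]

/-- One-sided estimate of a Gaussian orthant probability in terms of the Gram–Schmidt residuals
`x i - y i` of the defining vectors. -/
theorem stdGaussian_orthant_le {q h t : ℝ} (hq : 0 ≤ q)
    (htan : ∀ u, (gaussianReal 0 1).real (Set.Iic u) ≤ q * Real.exp (h * (u - t))) :
    ∀ {m : ℕ} (x y : Fin m → E) (τ : Fin m → ℝ), (∀ i j, j < i → ⟪x i - y i, x j⟫ = 0) →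
      (∀ i, ⟪x i - y i, y i⟫ = 0) → (∀ i, 0 < ‖x i - y i‖) →
      stdGaussian E {g | ∀ i, ⟪x i, g⟫ ≤ τ i} ≤ ENNReal.ofReal (q ^ m *
        Real.exp (h * ∑ i, (τ i / ‖x i - y i‖ - t) +
          h ^ 2 / 2 * (‖∑ i, ‖x i - y i‖⁻¹ • x i‖ ^ 2 - m))) := by
  intro m
  induction m with
  | zero =>
    intro x y τ _ _ _
    simp
  | succ m ih =>
    intro x y τ horth hself hL
    set l := Fin.last m with hl
    set L := ‖x l - y l‖ with hLdef
    have hLpos : 0 < L := hL l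
    set u : E := L⁻¹ • (x l - y l) with hu
    have hun : ‖u‖ = 1 := by
      rw [hu, norm_smul, norm_inv, Real.norm_of_nonneg hLpos.le, inv_mul_cancel₀ hLpos.ne']
    have hux : ∀ i : Fin m, ⟪x i.castSucc, u⟫ = 0 := by
      intro i
      rw [hu, real_inner_smul_right, real_inner_comm, horth l i.castSucc (Fin.castSucc_lt_last i),
        mul_zero]
    have huy : ⟪y l, u⟫ = 0 := by
      rw [hu, real_inner_smul_right, real_inner_comm, hself l, mul_zero]
    have hxl : x l = y l + L • u := by
      rw [hu, smul_smul, mul_inv_cancel₀ hLpos.ne', one_smul, add_sub_cancel]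
    clear_value u
    have huu : ⟪u, u⟫ = 1 := by rw [real_inner_self_eq_norm_sq, hun, one_pow]
    set B : Set E := {g | ∀ i : Fin m, ⟪x i.castSucc, g⟫ ≤ τ i.castSucc} with hB
    have hBm : MeasurableSet B := measurableSet_orthant _ _
    have hAm := measurableSet_orthant x τ
    set v : E := (-(h / L)) • y l with hv
    -- The earlier x_i are orthogonal to u, so resampling along u does not affect their constraints,
    -- while the last one becomes ξ ≤ (τ_l - ⟨y_l, g⟩)/L. The tangent bound makes its probability
    -- the exponential of an affine function of g with gradient v. The vanishing quadratic term is
    -- the case κ = 1 of the completion of the square.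
    have step1 : stdGaussian E {g | ∀ i, ⟪x i, g⟫ ≤ τ i} ≤
        ∫⁻ g, ENNReal.ofReal (q * Real.exp (h * (τ l / L - t))) *
          (ENNReal.ofReal (Real.exp (⟪v, g⟫ + (1 - ((1 : ℝ) ^ 2)⁻¹) / 2 * ‖g‖ ^ 2)) *
            B.indicator 1 g) ∂(stdGaussian E) := by
      rw [← lintegral_indicator_one hAm,
        lintegral_stdGaussian_resample hun (measurable_one.indicator hAm)]
      refine lintegral_mono fun g => ?_
      by_cases hg : g ∈ B
      · have hsub : ∀ ξ : ℝ, ({g : E | ∀ i, ⟪x i, g⟫ ≤ τ i}.indicator 1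
            (g - ⟪u, g⟫ • u + ξ • u) : ENNReal) ≤
            (Set.Iic ((τ l - ⟪y l, g⟫) / L)).indicator 1 ξ := by
          intro ξ
          by_cases hmem : g - ⟪u, g⟫ • u + ξ • u ∈ {g : E | ∀ i, ⟪x i, g⟫ ≤ τ i}
          · have h1 : ⟪x l, g - ⟪u, g⟫ • u + ξ • u⟫ ≤ τ l := hmem l
            rw [hxl, inner_add_left, inner_add_right, inner_sub_right, real_inner_smul_right,
              real_inner_smul_right, huy, real_inner_smul_left, inner_add_right, inner_sub_right,
              real_inner_smul_right, real_inner_smul_right, huu] at h1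
            have h2 : ξ ∈ Set.Iic ((τ l - ⟪y l, g⟫) / L) := by
              rw [Set.mem_Iic, le_div_iff₀ hLpos]
              linarith
            rw [Set.indicator_of_mem hmem, Set.indicator_of_mem h2]
            simp
          · rw [Set.indicator_of_notMem hmem]
            exact zero_le
        refine (lintegral_mono hsub).trans ?_
        rw [lintegral_indicator_one measurableSet_Iic, Set.indicator_of_mem hg, Pi.one_apply,
          mul_one, ← ENNReal.ofReal_mul (by positivity), ← ENNReal.ofReal_toReal (measure_ne_top _ _)]
        refine ENNReal.ofReal_le_ofReal ((htan _).trans_eq ?_)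
        rw [mul_assoc, ← Real.exp_add]
        congr 2
        rw [hv, real_inner_smul_left]
        field_simp
        ring
      · have h0 : ∀ ξ : ℝ, ({g : E | ∀ i, ⟪x i, g⟫ ≤ τ i}.indicator 1
            (g - ⟪u, g⟫ • u + ξ • u) : ENNReal) = 0 := by
          intro ξ
          refine Set.indicator_of_notMem (fun hmem => hg fun i => ?_) _
          have := hmem i.castSucc
          simpa [inner_add_right, inner_sub_right, real_inner_smul_right, hux i] using this
        simp [h0]
    -- Removing the tilt by a shift along v only changes thresholds, so what remains is again an
    -- orthant and the induction hypothesis applies.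
    have hx' : ∀ g : E, (B.indicator 1 ((1 : ℝ) • g + (1 : ℝ) ^ 2 • v) : ENNReal) =
        {g : E | ∀ i : Fin m, ⟪x i.castSucc, g⟫ ≤
          τ i.castSucc + h / L * ⟪x i.castSucc, y l⟫}.indicator 1 g := by
      intro g
      simp only [Set.indicator_apply, hB, Set.mem_ofPred_eq, one_smul, one_pow, inner_add_right, hv,
        real_inner_smul_right]
      congr 1
      refine propext (forall_congr' fun i => ?_)
      constructor <;> intro h' <;> linarith
    refine step1.trans ?_
    rw [lintegral_const_mul _ (by
        refine Measurable.mul (by fun_prop) (measurable_one.indicator hBm)),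
      lintegral_stdGaussian_exp_quadratic_mul one_pos v (measurable_one.indicator hBm)]
    simp_rw [hx']
    rw [lintegral_indicator_one (measurableSet_orthant _ _)]
    refine (mul_le_mul_right (mul_le_mul_right (ih (fun i => x i.castSucc) (fun i => y i.castSucc)
      _ (fun i j hij => horth _ _ (Fin.castSucc_lt_castSucc_iff.2 hij)) (fun i => hself _)
      (fun i => hL _)) _) _).trans_eq ?_
    rw [← ENNReal.ofReal_mul (by positivity), ← ENNReal.ofReal_mul (by positivity)]
    congr 1
    rw [Fin.sum_univ_castSucc, Fin.sum_univ_castSucc]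
    set Y : E := ∑ i : Fin m, ‖x i.castSucc - y i.castSucc‖⁻¹ • x i.castSucc with hY
    have hYu : ⟪Y, u⟫ = 0 := by
      rw [hY, sum_inner]
      refine Finset.sum_eq_zero fun i _ => ?_
      rw [real_inner_smul_left, hux, mul_zero]
    have hsum : ∑ i : Fin m, ((τ i.castSucc + h / L * ⟪x i.castSucc, y l⟫) /
        ‖x i.castSucc - y i.castSucc‖ - t) =
        ∑ i : Fin m, (τ i.castSucc / ‖x i.castSucc - y i.castSucc‖ - t) + h / L * ⟪Y, y l⟫ := by
      rw [hY, sum_inner, Finset.mul_sum, ← Finset.sum_add_distrib]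
      refine Finset.sum_congr rfl fun i _ => ?_
      rw [real_inner_smul_left]
      ring
    -- The cross term matches the shifted thresholds, the term in ‖y_l‖² matches the completed
    -- square, and the 1 is cancelled by m becoming m + 1.
    have hnorm : ‖Y + L⁻¹ • x l‖ ^ 2 = ‖Y‖ ^ 2 + 2 / L * ⟪Y, y l⟫ + (L⁻¹ ^ 2 * ‖y l‖ ^ 2 + 1) := by
      have h1 : Y + L⁻¹ • x l = (Y + L⁻¹ • y l) + u := by
        rw [hxl, smul_add, smul_smul, inv_mul_cancel₀ hLpos.ne', one_smul, add_assoc]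
      rw [h1, norm_add_sq_real (Y + L⁻¹ • y l) u, inner_add_left, hYu, real_inner_smul_left, huy,
        hun, norm_add_sq_real, norm_smul, real_inner_smul_right, norm_inv,
        Real.norm_of_nonneg hLpos.le]
      ring
    rw [hsum, ← hl, ← hLdef, hnorm, hv, norm_smul, Real.norm_eq_abs, mul_pow, sq_abs]
    simp only [one_pow, one_mul]
    rw [pow_succ q m]
    have e1 : ∀ a b c d : ℝ, q * Real.exp a * (Real.exp b * (q ^ m * Real.exp c)) =
        q ^ m * q * Real.exp (a + b + c) := by
      intro a b c d
      rw [Real.exp_add, Real.exp_add]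
      ring
    rw [e1 _ _ _ 0]
    congr 2
    push_cast
    field_simp
    ring

/-- The same estimate for a Gaussian vector of covariance `w² I`, with an exponential tilt that is
quadratic in the vector. -/
theorem lintegral_tilted_orthant_le {q h c w θ κ : ℝ} (hq : 0 ≤ q) (hw : 0 < w) (hκ : 0 < κ)
    (hθ : 2 * θ * w ^ 2 = 1 - (κ ^ 2)⁻¹)
    (htan : ∀ u, (gaussianReal 0 1).real (Set.Iic u) ≤ q * Real.exp (h * (u - -c)))
    {m : ℕ} (x y : Fin m → E) (V : E) (horth : ∀ i j, j < i → ⟪x i - y i, x j⟫ = 0)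
    (hself : ∀ i, ⟪x i - y i, y i⟫ = 0) (hL : ∀ i, 0 < ‖x i - y i‖) :
    ∫⁻ g, ENNReal.ofReal (Real.exp (⟪V, g⟫ + θ * (‖g‖ ^ 2 - 1))) *
        {g : E | ∀ i, ⟪x i, g⟫ ≤ -c * w}.indicator 1 g ∂((stdGaussian E).map (w • ·)) ≤
      ENNReal.ofReal (Real.exp (-θ) * κ ^ Module.finrank ℝ E * q ^ m *
        Real.exp (κ ^ 2 * w ^ 2 * ‖V‖ ^ 2 / 2 +
          h * ∑ i, ((-c / κ - κ * w * ⟪x i, V⟫) / ‖x i - y i‖ + c) +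
          h ^ 2 / 2 * (‖∑ i, ‖x i - y i‖⁻¹ • x i‖ ^ 2 - m))) := by
  have hAm := measurableSet_orthant x (fun _ => -c * w)
  rw [lintegral_map (by exact Measurable.mul (by fun_prop) (measurable_one.indicator hAm))
    (by fun_prop)]
  have h1 : ∀ g : E, ENNReal.ofReal (Real.exp (⟪V, w • g⟫ + θ * (‖w • g‖ ^ 2 - 1))) *
        ({g : E | ∀ i, ⟪x i, g⟫ ≤ -c * w}.indicator 1 (w • g) : ENNReal) =
      ENNReal.ofReal (Real.exp (-θ)) *
        (ENNReal.ofReal (Real.exp (⟪w • V, g⟫ + (1 - (κ ^ 2)⁻¹) / 2 * ‖g‖ ^ 2)) *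
        {g : E | ∀ i, ⟪x i, g⟫ ≤ -c}.indicator 1 g) := by
    intro g
    rw [← mul_assoc, ← ENNReal.ofReal_mul (Real.exp_pos _).le, ← Real.exp_add]
    congr 1
    · congr 2
      rw [← hθ, norm_smul, real_inner_smul_right, real_inner_smul_left, mul_pow, Real.norm_eq_abs,
        sq_abs]
      ring
    · simp only [Set.indicator_apply, Set.mem_ofPred_eq, real_inner_smul_right]
      congr 1
      refine propext (forall_congr' fun i => ?_)
      rw [mul_comm w, mul_le_mul_iff_left₀ hw]
  simp_rw [h1]
  have hAm' := measurableSet_orthant x (fun _ => -c)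
  rw [lintegral_const_mul _
      (by exact Measurable.mul (by fun_prop) (measurable_one.indicator hAm')),
    lintegral_stdGaussian_exp_quadratic_mul hκ _ (measurable_one.indicator hAm')]
  have h2 : ∀ g : E, ({g : E | ∀ i, ⟪x i, g⟫ ≤ -c}.indicator 1 (κ • g + κ ^ 2 • w • V) : ENNReal) =
      {g : E | ∀ i, ⟪x i, g⟫ ≤ -c / κ - κ * w * ⟪x i, V⟫}.indicator 1 g := by
    intro g
    simp only [Set.indicator_apply, Set.mem_ofPred_eq, inner_add_right, real_inner_smul_right]
    congr 1
    refine propext (forall_congr' fun i => ?_)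
    rw [le_sub_iff_add_le, le_div_iff₀ hκ]
    constructor <;> intro h' <;> linarith
  simp_rw [h2]
  rw [lintegral_indicator_one (measurableSet_orthant _ _)]
  refine (mul_le_mul_right (mul_le_mul_right (stdGaussian_orthant_le hq htan x y _ horth hself hL)
    _) _).trans_eq ?_
  rw [← ENNReal.ofReal_mul (by positivity), ← ENNReal.ofReal_mul (by positivity)]
  congr 1
  have e1 : ∀ e K a b c : ℝ, e * (K * Real.exp a * (q ^ m * Real.exp (b + c))) =
      e * K * q ^ m * Real.exp (a + b + c) := by
    intro e K a b c
    rw [Real.exp_add, Real.exp_add, Real.exp_add]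
    ring
  rw [e1]
  congr 2
  simp only [sub_neg_eq_add, norm_smul, mul_pow, Real.norm_eq_abs, sq_abs]
  ring

end Orthant

/-! ### Scalar estimates -/

theorem abs_one_sub_inv_sub_le {L : ℝ} (hL : 1 / 2 ≤ L) :
    |1 - L⁻¹ - (L ^ 2 - 1) / 2| ≤ 2 * (L ^ 2 - 1) ^ 2 := by
  have hpos : 0 < L := by linarith
  have h1 : 1 - L⁻¹ - (L ^ 2 - 1) / 2 = -((L - 1) ^ 2 * ((L + 2) / (2 * L))) := by
    field_simp
    ring
  have h2 : (L + 2) / (2 * L) ≤ 2 * (L + 1) ^ 2 := by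
    rw [div_le_iff₀ (by positivity)]
    nlinarith [mul_pos hpos hpos, mul_pos (mul_pos hpos hpos) hpos]
  rw [h1, abs_neg, abs_of_nonneg (by positivity)]
  calc (L - 1) ^ 2 * ((L + 2) / (2 * L)) ≤ (L - 1) ^ 2 * (2 * (L + 1) ^ 2) :=
        mul_le_mul_of_nonneg_left h2 (sq_nonneg _)
    _ = 2 * (L ^ 2 - 1) ^ 2 := by ring

/-- The quadratic majorant of `h c (1 - 1 / ‖x‖)`, as a function of `s = ‖x‖² - 1`. -/
noncomputable def normPotential (M h c s : ℝ) : ℝ := h * c / 2 * s + 4 * M ^ 2 * s ^ 2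

/-- Here L is a residual length, s the deviation of the squared norm and b the squared length of the
projection removed. The term linear in s keeps its sign because it averages out later; only the
quadratic remainder and b are estimated in absolute value. -/
theorem mul_one_sub_inv_le_normPotential {M h c L s b : ℝ} (hh : 0 ≤ h) (hhM : h ≤ M)
    (hc : |c| ≤ M) (hL : 1 / 2 ≤ L) (hLs : L ^ 2 = 1 + s - b) (hb0 : 0 ≤ b) (hb1 : b ≤ 1) :
    h * c * (1 - L⁻¹) ≤ normPotential M h c s + 5 * M ^ 2 * b := by
  have h1 := abs_one_sub_inv_sub_le hL
  have hM : 0 ≤ M := hh.trans hhM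
  have hhc : |h * c| ≤ M ^ 2 := by
    rw [abs_mul, abs_of_nonneg hh, sq]
    exact mul_le_mul hhM hc (abs_nonneg _) hM
  have h2 : h * c * (1 - L⁻¹) = h * c / 2 * s - h * c / 2 * b +
      h * c * (1 - L⁻¹ - (L ^ 2 - 1) / 2) := by
    rw [hLs]
    ring
  have h3 : h * c * (1 - L⁻¹ - (L ^ 2 - 1) / 2) ≤ M ^ 2 * (2 * (L ^ 2 - 1) ^ 2) := by
    refine (le_abs_self _).trans ?_
    rw [abs_mul]
    exact mul_le_mul hhc h1 (abs_nonneg _) (sq_nonneg _)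
  have h4 : (L ^ 2 - 1) ^ 2 ≤ 2 * s ^ 2 + 2 * b := by
    rw [hLs]
    nlinarith [sq_nonneg (s + b), mul_le_of_le_one_right hb0 hb1]
  have h5 : -(h * c / 2 * b) ≤ M ^ 2 * b := by
    have := (abs_le.1 hhc).1
    nlinarith [sq_nonneg M]
  rw [h2, normPotential]
  nlinarith [sq_nonneg M]

/-- With s = ‖g‖² - 1, tilts linear in s are Gaussian integrals but the s² part is not. It is
replaced by linear tilts through exp y ≤ 1 + 2y on [0,1] and s² ≤ 2w²(exp(s/w) + exp(-s/w)); w is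
the order of the standard deviation of s. -/
theorem exp_normPotential_le {M h c w n s : ℝ} (hw : 0 < w) (hn : 0 ≤ n)
    (hs : n * (4 * M ^ 2 * s ^ 2) ≤ 1) :
    Real.exp (n * normPotential M h c s) ≤ Real.exp (n * (h * c / 2) * s) +
      16 * M ^ 2 * n * w ^ 2 * Real.exp ((n * (h * c / 2) + w⁻¹) * s) +
      16 * M ^ 2 * n * w ^ 2 * Real.exp ((n * (h * c / 2) - w⁻¹) * s) := by
  set θ := n * (h * c / 2)
  have h1 : Real.exp (n * (4 * M ^ 2 * s ^ 2)) ≤ 1 + 2 * (n * (4 * M ^ 2 * s ^ 2)) := by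
    have h0 : 0 ≤ n * (4 * M ^ 2 * s ^ 2) := by positivity
    have := Real.abs_exp_sub_one_le (abs_le.2 ⟨by linarith, hs⟩)
    rw [abs_of_nonneg h0] at this
    linarith [le_abs_self (Real.exp (n * (4 * M ^ 2 * s ^ 2)) - 1)]
  have h2 : s ^ 2 ≤ 2 * (w ^ 2 * (Real.exp (w⁻¹ * s) + Real.exp (-(w⁻¹ * s)))) := by
    have h3 : (w⁻¹ * s) ^ 2 ≤ 2 * (Real.exp (w⁻¹ * s) + Real.exp (-(w⁻¹ * s))) := by
      have h4 := Real.quadratic_le_exp_of_nonneg (abs_nonneg (w⁻¹ * s))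
      rw [sq_abs] at h4
      rcases abs_choice (w⁻¹ * s) with h5 | h5
      · have h6 := Real.add_one_le_exp (-(w⁻¹ * s))
        rw [h5] at h4
        linarith
      · have h6 := Real.add_one_le_exp (w⁻¹ * s)
        rw [h5] at h4
        linarith
    calc s ^ 2 = w ^ 2 * (w⁻¹ * s) ^ 2 := by field_simp
      _ ≤ _ := (mul_le_mul_of_nonneg_left h3 (sq_nonneg _)).trans_eq (by ring)
  have e0 : Real.exp (n * normPotential M h c s) =
      Real.exp (θ * s) * Real.exp (n * (4 * M ^ 2 * s ^ 2)) := by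
    rw [← Real.exp_add, normPotential]
    congr 1
    ring
  have e1 : Real.exp ((θ + w⁻¹) * s) = Real.exp (θ * s) * Real.exp (w⁻¹ * s) := by
    rw [← Real.exp_add]; congr 1; ring
  have e2 : Real.exp ((θ - w⁻¹) * s) = Real.exp (θ * s) * Real.exp (-(w⁻¹ * s)) := by
    rw [← Real.exp_add]; congr 1; ring
  rw [e0, e1, e2]
  have h6 : Real.exp (n * (4 * M ^ 2 * s ^ 2)) ≤
      1 + 16 * M ^ 2 * n * (w ^ 2 * (Real.exp (w⁻¹ * s) + Real.exp (-(w⁻¹ * s)))) := by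
    have : 8 * M ^ 2 * n * s ^ 2 ≤
      8 * M ^ 2 * n * (2 * (w ^ 2 * (Real.exp (w⁻¹ * s) + Real.exp (-(w⁻¹ * s))))) :=
      mul_le_mul_of_nonneg_left h2 (by positivity)
    linarith
  have := mul_le_mul_of_nonneg_left h6 (Real.exp_pos (θ * s)).le
  linarith

/-- The normalising factor of a Gaussian tilted by `θ (‖x‖² - 1)`. -/
theorem exp_neg_mul_pow_le {θ w κ : ℝ} {d : ℕ} (hd : (d : ℝ) * w ^ 2 = 1)
    (hθ : 2 * θ * w ^ 2 = 1 - (κ ^ 2)⁻¹) (hsmall : |2 * θ * w ^ 2| ≤ 1 / 2) :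
    Real.exp (-θ) * κ ^ d ≤ Real.exp (2 * θ ^ 2 * w ^ 2) := by
  set x := 2 * θ * w ^ 2 with hx
  obtain ⟨hx1, hx2⟩ := abs_le.1 hsmall
  have hκ2 : κ ^ 2 = (1 - x)⁻¹ := by rw [hθ]; simp
  have h1 : (1 - x)⁻¹ ≤ Real.exp (x + x ^ 2) := by
    rcases le_total x 0 with h | h
    · refine le_trans ?_ (Real.add_one_le_exp _)
      rw [inv_le_iff_one_le_mul₀ (by linarith)]
      nlinarith [mul_nonneg (sq_nonneg x) (neg_nonneg.2 h)]
    · refine le_trans ?_ (Real.quadratic_le_exp_of_nonneg (by positivity))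
      rw [inv_le_iff_one_le_mul₀ (by linarith)]
      nlinarith [mul_nonneg h h, mul_nonneg (mul_nonneg h h) h,
        mul_nonneg (mul_nonneg (mul_nonneg h h) h) (sub_nonneg.2 hx2),
        mul_nonneg (mul_nonneg h h) (sub_nonneg.2 hx2)]
  have h2 : (κ ^ d) ^ 2 ≤ (Real.exp (θ + 2 * θ ^ 2 * w ^ 2)) ^ 2 := by
    rw [← pow_mul, mul_comm, pow_mul, hκ2]
    calc ((1 - x)⁻¹) ^ d ≤ (Real.exp (x + x ^ 2)) ^ d :=
          pow_le_pow_left₀ (inv_nonneg.2 (by linarith)) h1 d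
      _ = (Real.exp (θ + 2 * θ ^ 2 * w ^ 2)) ^ 2 := by
          rw [← Real.exp_nat_mul, ← Real.exp_nat_mul]
          congr 1
          have : (d : ℝ) * (x + x ^ 2) = 2 * θ * (d * w ^ 2) + 4 * θ ^ 2 * w ^ 2 * (d * w ^ 2) := by
            rw [hx]; ring
          rw [this, hd]
          push_cast
          ring
  have h3 := le_of_sq_le_sq h2 (Real.exp_pos _).le
  calc Real.exp (-θ) * κ ^ d ≤ Real.exp (-θ) * Real.exp (θ + 2 * θ ^ 2 * w ^ 2) :=
        mul_le_mul_of_nonneg_left h3 (Real.exp_pos _).le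
    _ = _ := by rw [← Real.exp_add]; congr 1; ring

theorem abs_sub_one_le_of_sq_inv {κ x : ℝ} (hκ : 0 < κ) (hx : x = 1 - (κ ^ 2)⁻¹)
    (hsmall : |x| ≤ 1 / 2) : |κ - 1| ≤ |x| ∧ |1 - κ⁻¹| ≤ |x| ∧ κ ^ 2 ≤ 2 := by
  obtain ⟨hx1, hx2⟩ := abs_le.1 hsmall
  set r := κ⁻¹ with hr
  have hr0 : 0 < r := inv_pos.2 hκ
  have hxr : x = (1 - r) * (1 + r) := by
    rw [hx, ← inv_pow]; ring
  have hκr : κ = r⁻¹ := by rw [hr, inv_inv]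
  have hr12 : 1 / 2 ≤ r := by nlinarith
  have h1 : |x| = |1 - r| * (1 + r) := by
    rw [hxr, abs_mul, abs_of_pos (by linarith : 0 < 1 + r)]
  have h2 : κ - 1 = (1 - r) * κ := by rw [hκr]; field_simp
  have h4 : κ ^ 2 ≤ 2 := by
    rw [hκr, inv_pow, inv_le_comm₀ (by positivity) (by norm_num)]
    nlinarith
  have h3 : κ ≤ 1 + r := by
    rw [hκr, inv_le_iff_one_le_mul₀ hr0]
    nlinarith
  refine ⟨?_, ?_, h4⟩
  · rw [h2, h1, abs_mul, abs_of_pos hκ]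
    exact mul_le_mul_of_nonneg_left h3 (abs_nonneg _)
  · rw [h1]
    exact le_mul_of_one_le_right (abs_nonneg _) (by linarith)

theorem abs_inv_sub_one_le {L s b η : ℝ} (hL0 : 0 ≤ L) (hLs : L ^ 2 = 1 + s - b) (hs : |s| ≤ η)
    (hb0 : 0 ≤ b) (hb : b ≤ η) (hη : η ≤ 1 / 8) : 1 / 2 ≤ L ∧ |L⁻¹ - 1| ≤ 4 * η := by
  obtain ⟨hs1, hs2⟩ := abs_le.1 hs
  have hL : 3 / 4 ≤ L := by nlinarith
  refine ⟨by linarith, ?_⟩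
  have hpos : 0 < L := by linarith
  have h1 : L⁻¹ - 1 = (b - s) * (L * (1 + L))⁻¹ := by
    have : b - s = (1 - L) * (1 + L) := by nlinarith
    rw [this]
    field_simp
  have h2 : (L * (1 + L))⁻¹ ≤ 2 := by
    rw [inv_le_comm₀ (by positivity) (by norm_num)]
    nlinarith
  rw [h1, abs_mul, abs_of_pos (by positivity : 0 < (L * (1 + L))⁻¹)]
  have h3 : |b - s| ≤ 2 * η := abs_le.2 ⟨by linarith, by linarith⟩
  nlinarith [abs_nonneg (b - s), inv_pos.2 (by positivity : 0 < L * (1 + L))]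

theorem abs_mul_sub_one_le {a b η : ℝ} (ha : |a - 1| ≤ 4 * η) (hb : |b - 1| ≤ 4 * η)
    (hη : η ≤ 1 / 16) : |a * b - 1| ≤ 10 * η := by
  have h0 : 0 ≤ η := by linarith [abs_nonneg (a - 1)]
  have h1 : a * b - 1 = (a - 1) * (b - 1) + (a - 1) + (b - 1) := by ring
  have h2 : |(a - 1) * (b - 1)| ≤ 4 * η * (4 * η) := by
    rw [abs_mul]
    exact mul_le_mul ha hb (abs_nonneg _) (by linarith)
  rw [h1]
  refine (abs_add_three _ _ _).trans ?_
  nlinarith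

/-! ### The exponent produced by integrating out one vector -/

section Exponent

variable {E : Type*} [NormedAddCommGroup E] [InnerProductSpace ℝ E]

/-- Half the sum of the inner products `⟪x i, x j⟫` over ordered pairs of distinct indices. -/
noncomputable def pairSum {k : ℕ} (x : Fin k → E) : ℝ := (‖∑ i, x i‖ ^ 2 - ∑ i, ‖x i‖ ^ 2) / 2

theorem norm_sq_sum_smul {k : ℕ} (x : Fin k → E) (a : Fin k → ℝ) :
    ‖∑ i, a i • x i‖ ^ 2 = ∑ i, a i ^ 2 * ‖x i‖ ^ 2 +
      ∑ i, ∑ j ∈ Finset.univ.erase i, a i * a j * ⟪x i, x j⟫ := by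
  rw [← real_inner_self_eq_norm_sq, sum_inner, ← Finset.sum_add_distrib]
  refine Finset.sum_congr rfl fun i _ => ?_
  rw [inner_sum, ← Finset.add_sum_erase _ _ (Finset.mem_univ i)]
  simp only [real_inner_smul_left, real_inner_smul_right]
  rw [real_inner_self_eq_norm_sq]
  exact congrArg₂ _ (by ring) (Finset.sum_congr rfl fun _ _ => by ring)

theorem two_mul_pairSum {k : ℕ} (x : Fin k → E) :
    2 * pairSum x = ∑ i, ∑ j ∈ Finset.univ.erase i, ⟪x i, x j⟫ := by
  have := norm_sq_sum_smul x (fun _ => 1)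
  simp only [one_smul, one_pow, one_mul] at this
  rw [pairSum, this]
  ring

theorem sum_sum_erase_le {k : ℕ} (f : Fin k → Fin k → ℝ) {b : ℝ} (hb : 0 ≤ b)
    (hf : ∀ i j, i ≠ j → f i j ≤ b) :
    ∑ i, ∑ j ∈ Finset.univ.erase i, f i j ≤ b * k ^ 2 := by
  calc ∑ i, ∑ j ∈ Finset.univ.erase i, f i j ≤ ∑ _i : Fin k, ∑ _j : Fin k, b := by
        refine Finset.sum_le_sum fun i _ => ?_
        refine (Finset.sum_le_sum fun j hj => hf i j (Finset.ne_of_mem_erase hj).symm).trans ?_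
        exact Finset.sum_le_sum_of_subset_of_nonneg (Finset.erase_subset _ _) fun _ _ _ => hb
    _ = b * k ^ 2 := by
        simp
        ring

/-- For v = σ⟨x_i, x_j⟩, the sum |v| + v is twice the positive part of v, which the clique condition
bounds by M w. Thus a one-sided bound on the inner products controls their absolute values by their
sum. -/
theorem sum_sum_abs_inner_le {k : ℕ} {x : Fin k → E} {σ c w M : ℝ} (hσ : σ = 1 ∨ σ = -1)
    (hw : 0 ≤ w) (hc : |c| ≤ M) (hx : ∀ i j, i ≠ j → σ * ⟪x i, x j⟫ ≤ -c * w) :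
    ∑ i, ∑ j ∈ Finset.univ.erase i, |⟪x i, x j⟫| ≤ -2 * σ * pairSum x + 2 * M * w * k ^ 2 := by
  have hcM := (abs_le.1 hc).1
  have h1 : ∑ i, ∑ j ∈ Finset.univ.erase i, (|⟪x i, x j⟫| + σ * ⟪x i, x j⟫) ≤
      2 * M * w * k ^ 2 := by
    refine sum_sum_erase_le (fun i j => |⟪x i, x j⟫| + σ * ⟪x i, x j⟫)
      (by have := (abs_nonneg c).trans hc; positivity) fun i j hij => ?_
    have h2 := hx i j hij
    have h3 : -c * w ≤ M * w := mul_le_mul_of_nonneg_right (by linarith) hw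
    have h4 : |⟪x i, x j⟫| = |σ * ⟪x i, x j⟫| := by
      rcases hσ with h | h <;> simp [h]
    rw [h4]
    rcases abs_cases (σ * ⟪x i, x j⟫) with ⟨h5, _⟩ | ⟨h5, _⟩
    · linarith
    · have := (abs_nonneg c).trans hc
      rw [h5]
      nlinarith
  simp_rw [Finset.sum_add_distrib, ← Finset.mul_sum] at h1
  rw [← two_mul_pairSum] at h1
  linarith

theorem sum_norm_sq_bounds {E : Type*} [NormedAddCommGroup E] {k : ℕ} {x : Fin k → E} {δ : ℝ} (hx : ∀ i, |‖x i‖ ^ 2 - 1| ≤ δ) :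
    |∑ i, ‖x i‖ ^ 2 - k| ≤ k * δ := by
  have h : ∑ i, ‖x i‖ ^ 2 - k = ∑ i, (‖x i‖ ^ 2 - 1) := by simp
  rw [h]
  refine (Finset.abs_sum_le_sum_abs _ _).trans ?_
  refine (Finset.sum_le_sum fun i _ => hx i).trans ?_
  simp

theorem sum_abs_inner_sum_le {k : ℕ} (x : Fin k → E) :
    ∑ i, |⟪x i, ∑ j, x j⟫| ≤ ∑ i, ‖x i‖ ^ 2 +
      ∑ i, ∑ j ∈ Finset.univ.erase i, |⟪x i, x j⟫| := by
  rw [← Finset.sum_add_distrib]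
  refine Finset.sum_le_sum fun i _ => ?_
  rw [inner_sum, ← Finset.add_sum_erase _ _ (Finset.mem_univ i), real_inner_self_eq_norm_sq]
  refine (abs_add_le _ _).trans ?_
  rw [abs_of_nonneg (sq_nonneg _)]
  exact add_le_add le_rfl (Finset.abs_sum_le_sum_abs _ _)

set_option maxHeartbeats 1000000 in
-- Expands the exponent of `lintegral_tilted_orthant_le` around L_i = κ = 1. The diagonal of ⟨x_i,
-- lam ∑ x_j⟩ gives -σ h lam w k and the quadratic form gives h² · `pairSum`. Off-diagonal errors
-- appear as η times a sum of absolute values and go into the coefficient of `pairSum`.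
theorem orthant_exponent_le {k : ℕ} {x : Fin k → E} {L b : Fin k → ℝ}
    {σ h c w M η lam κ χ β δ : ℝ}
    (hσ : σ = 1 ∨ σ = -1) (hh : 0 ≤ h) (hhM : h ≤ M) (hc : |c| ≤ M) (hw : 0 < w)
    (hη : η ≤ 1 / 16) (hδη : δ ≤ η) (hβ : β ≤ η)
    (hx : ∀ i j, i ≠ j → σ * ⟪x i, x j⟫ ≤ -c * w) (hnorm : ∀ i, |‖x i‖ ^ 2 - 1| ≤ δ)
    (hL0 : ∀ i, 0 ≤ L i) (hL : ∀ i, L i ^ 2 = ‖x i‖ ^ 2 - b i) (hb0 : ∀ i, 0 ≤ b i)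
    (hb : ∀ i, b i ≤ β) (hκ : 0 < κ) (hχ : χ = 1 - (κ ^ 2)⁻¹) (hχη : |χ| ≤ 4 * η) :
    κ ^ 2 * w ^ 2 * ‖lam • ∑ i, x i‖ ^ 2 / 2 +
          h * ∑ i, ((-c / κ - κ * w * ⟪σ • x i, lam • ∑ i, x i⟫) / L i + c) +
          h ^ 2 / 2 * (‖∑ i, (L i)⁻¹ • σ • x i‖ ^ 2 - k) ≤
      -σ * h * lam * w * k + ∑ i, normPotential M h c (‖x i‖ ^ 2 - 1) +
      (2 * lam ^ 2 * w ^ 2 - 2 * h * σ * lam * w - 20 * σ * h * |lam| * w * η + h ^ 2 -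
        10 * σ * h ^ 2 * η) * pairSum x +
      (h * |lam| * w * k * δ + 20 * h * |lam| * w * η * k + 20 * h * |lam| * w * η * M * w * k ^ 2 +
        5 * k * M ^ 2 * β + 2 * k * M ^ 2 * |χ| + 2 * k * lam ^ 2 * w ^ 2 + 2 * h ^ 2 * k * β +
        10 * h ^ 2 * η * M * w * k ^ 2) := by
  have hM : 0 ≤ M := hh.trans hhM
  have hσ2 : σ ^ 2 = 1 := by rcases hσ with h | h <;> rw [h] <;> norm_num
  have hσa : |σ| = 1 := by rcases hσ with h | h <;> rw [h] <;> norm_num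
  have hη0 : 0 ≤ η := by linarith [abs_nonneg χ]
  obtain ⟨hκ1, hκ2, hκ3⟩ := abs_sub_one_le_of_sq_inv hκ hχ (by linarith)
  have hLb : ∀ i, 1 / 2 ≤ L i ∧ |(L i)⁻¹ - 1| ≤ 4 * η := fun i =>
    abs_inv_sub_one_le (s := ‖x i‖ ^ 2 - 1) (b := b i) (hL0 i) (by rw [hL i]; ring)
      ((hnorm i).trans hδη) (hb0 i) ((hb i).trans hβ) (by linarith)
  have hLpos : ∀ i, 0 < L i := fun i => by linarith [(hLb i).1]
  have hLinv : ∀ i, (L i)⁻¹ ≤ 2 := fun i => by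
    rw [inv_le_comm₀ (hLpos i) (by norm_num)]
    linarith [(hLb i).1]
  set X := ∑ i, x i with hX
  set S := pairSum x with hS
  set A := ∑ i, ∑ j ∈ Finset.univ.erase i, |⟪x i, x j⟫| with hA
  have hAle : A ≤ -2 * σ * S + 2 * M * w * k ^ 2 := sum_sum_abs_inner_le hσ hw.le hc hx
  have hXS : ‖X‖ ^ 2 = ∑ i, ‖x i‖ ^ 2 + 2 * S := by rw [hS, pairSum]; ring
  have hN := sum_norm_sq_bounds hnorm
  set N := ∑ i, ‖x i‖ ^ 2 with hNdef
  obtain ⟨hN1, hN2⟩ := abs_le.1 hN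
  have hk0 : (0 : ℝ) ≤ k := Nat.cast_nonneg k
  have hN3 : N ≤ 2 * k := by nlinarith
  -- the tilt
  have t1 : κ ^ 2 * w ^ 2 * ‖lam • X‖ ^ 2 / 2 ≤ 2 * k * lam ^ 2 * w ^ 2 +
      2 * lam ^ 2 * w ^ 2 * S := by
    rw [norm_smul, mul_pow, Real.norm_eq_abs, sq_abs]
    have h0 : 0 ≤ w ^ 2 * (lam ^ 2 * ‖X‖ ^ 2) := by positivity
    have h1 : κ ^ 2 * w ^ 2 * (lam ^ 2 * ‖X‖ ^ 2) / 2 ≤ w ^ 2 * (lam ^ 2 * ‖X‖ ^ 2) := by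
      nlinarith
    have h2 : w ^ 2 * lam ^ 2 * N ≤ w ^ 2 * lam ^ 2 * (2 * k) :=
      mul_le_mul_of_nonneg_left hN3 (by positivity)
    rw [hXS] at h1
    rw [hXS]
    linarith
  -- the thresholds
  have t2 : ∀ i, h * (-c / κ / L i + c) ≤ normPotential M h c (‖x i‖ ^ 2 - 1) + 5 * M ^ 2 * β +
      2 * M ^ 2 * |χ| := by
    intro i
    have h1 := mul_one_sub_inv_le_normPotential (s := ‖x i‖ ^ 2 - 1) (b := b i) hh hhM hc
      (hLb i).1 (by rw [hL i]; ring) (hb0 i) (by linarith [hb i])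
    have h2 : h * (-c / κ / L i + c) = h * c * (1 - (L i)⁻¹) +
        h * c * (L i)⁻¹ * (1 - κ⁻¹) := by
      field_simp
      ring
    have h3 : h * c * (L i)⁻¹ * (1 - κ⁻¹) ≤ 2 * M ^ 2 * |χ| := by
      refine (le_abs_self _).trans ?_
      rw [abs_mul, abs_mul, abs_mul, abs_of_nonneg hh, abs_of_pos (inv_pos.2 (hLpos i))]
      calc h * |c| * (L i)⁻¹ * |1 - κ⁻¹| ≤ M * M * 2 * |χ| := by
            have hi := (inv_pos.2 (hLpos i)).le
            have hi2 := hLinv i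
            gcongr
        _ = _ := by ring
    have h4 : 5 * M ^ 2 * b i ≤ 5 * M ^ 2 * β := by
      have := hb i
      gcongr
    linarith
  -- the interaction of the tilt with the thresholds
  have t3 : ∀ i, h * (-(κ * w * ⟪σ • x i, lam • X⟫) / L i) ≤
      -σ * h * lam * w * ⟪x i, X⟫ + 10 * h * |lam| * w * η * |⟪x i, X⟫| := by
    intro i
    have h1 : |κ * (L i)⁻¹ - 1| ≤ 10 * η :=
      abs_mul_sub_one_le (hκ1.trans hχη) (hLb i).2 hη
    have h2 : h * (-(κ * w * ⟪σ • x i, lam • X⟫) / L i) = -σ * h * lam * w * ⟪x i, X⟫ +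
        -(σ * h * lam * w * ⟪x i, X⟫ * (κ * (L i)⁻¹ - 1)) := by
      rw [real_inner_smul_left, real_inner_smul_right]
      field_simp
      ring
    rw [h2]
    refine add_le_add le_rfl ((neg_le_abs _).trans ?_)
    rw [abs_mul, abs_mul, abs_mul, abs_mul, abs_mul, hσa, abs_of_nonneg hh, abs_of_pos hw]
    calc 1 * h * |lam| * w * |⟪x i, X⟫| * |κ * (L i)⁻¹ - 1| ≤
        1 * h * |lam| * w * |⟪x i, X⟫| * (10 * η) := by gcongr
      _ = _ := by ring
  have t23 : h * ∑ i, ((-c / κ - κ * w * ⟪σ • x i, lam • X⟫) / L i + c) ≤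
      ∑ i, normPotential M h c (‖x i‖ ^ 2 - 1) + k * (5 * M ^ 2 * β + 2 * M ^ 2 * |χ|) +
      (-σ * h * lam * w * (N + 2 * S) + 10 * h * |lam| * w * η * (N + A)) := by
    have h1 : ∑ i, ⟪x i, X⟫ = N + 2 * S := by
      rw [← hXS, ← sum_inner, real_inner_self_eq_norm_sq]
    have h2 : ∑ i, |⟪x i, X⟫| ≤ N + A := sum_abs_inner_sum_le x
    have h3 : ∑ i, (-σ * h * lam * w * ⟪x i, X⟫ + 10 * h * |lam| * w * η * |⟪x i, X⟫|) =
        -σ * h * lam * w * (N + 2 * S) + 10 * h * |lam| * w * η * ∑ i, |⟪x i, X⟫| := by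
      rw [Finset.sum_add_distrib, ← Finset.mul_sum, ← Finset.mul_sum, h1]
    calc h * ∑ i, ((-c / κ - κ * w * ⟪σ • x i, lam • X⟫) / L i + c)
        ≤ ∑ i, ((normPotential M h c (‖x i‖ ^ 2 - 1) + (5 * M ^ 2 * β + 2 * M ^ 2 * |χ|)) +
          (-σ * h * lam * w * ⟪x i, X⟫ + 10 * h * |lam| * w * η * |⟪x i, X⟫|)) := by
          rw [Finset.mul_sum]
          refine Finset.sum_le_sum fun i _ => ?_
          have e : h * ((-c / κ - κ * w * ⟪σ • x i, lam • X⟫) / L i + c) =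
              h * (-c / κ / L i + c) + h * (-(κ * w * ⟪σ • x i, lam • X⟫) / L i) := by ring
          rw [e]
          linarith [t2 i, t3 i]
      _ = ∑ i, normPotential M h c (‖x i‖ ^ 2 - 1) + k * (5 * M ^ 2 * β + 2 * M ^ 2 * |χ|) +
          (-σ * h * lam * w * (N + 2 * S) + 10 * h * |lam| * w * η * ∑ i, |⟪x i, X⟫|) := by
          rw [Finset.sum_add_distrib, Finset.sum_add_distrib, h3]
          simp
          ring
      _ ≤ _ := add_le_add le_rfl
        (add_le_add le_rfl (mul_le_mul_of_nonneg_left h2 (by positivity)))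
  -- the quadratic form
  have t4 : ‖∑ i, (L i)⁻¹ • σ • x i‖ ^ 2 - k ≤ 4 * k * β + 2 * S + 10 * η * A := by
    have e1 : ∀ i, (L i)⁻¹ • σ • x i = ((L i)⁻¹ * σ) • x i := fun i => smul_smul _ _ _
    simp_rw [e1]
    rw [norm_sq_sum_smul]
    have h1 : ∑ i, ((L i)⁻¹ * σ) ^ 2 * ‖x i‖ ^ 2 ≤ ∑ _i : Fin k, (1 + 4 * β) := by
      refine Finset.sum_le_sum fun i _ => ?_
      -- Dividing by the residual length cancels the norm fluctuation on the diagonal exactly; only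
      -- the projection part b_i survives.
      have h2 : ((L i)⁻¹ * σ) ^ 2 * ‖x i‖ ^ 2 = 1 + (L i)⁻¹ ^ 2 * b i := by
        have h3 : ‖x i‖ ^ 2 = L i ^ 2 + b i := by rw [hL i]; ring
        rw [mul_pow, hσ2, h3]
        have := (hLpos i).ne'
        field_simp
      rw [h2]
      have h3 : (L i)⁻¹ ^ 2 ≤ 2 ^ 2 :=
        pow_le_pow_left₀ (inv_nonneg.2 (hL0 i)) (hLinv i) 2
      nlinarith [hb i, hb0 i]
    have h2 : ∑ i, ∑ j ∈ Finset.univ.erase i, (L i)⁻¹ * σ * ((L j)⁻¹ * σ) * ⟪x i, x j⟫ ≤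
        2 * S + 10 * η * A := by
      rw [hS, two_mul_pairSum, hA, Finset.mul_sum, ← Finset.sum_add_distrib]
      refine Finset.sum_le_sum fun i _ => ?_
      rw [Finset.mul_sum, ← Finset.sum_add_distrib]
      refine Finset.sum_le_sum fun j _ => ?_
      have h3 : (L i)⁻¹ * σ * ((L j)⁻¹ * σ) * ⟪x i, x j⟫ =
          ⟪x i, x j⟫ + ((L i)⁻¹ * (L j)⁻¹ - 1) * ⟪x i, x j⟫ := by
        linear_combination (L i)⁻¹ * (L j)⁻¹ * ⟪x i, x j⟫ * hσ2
      rw [h3]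
      refine add_le_add le_rfl ((le_abs_self _).trans ?_)
      rw [abs_mul]
      exact mul_le_mul_of_nonneg_right (abs_mul_sub_one_le (hLb i).2 (hLb j).2 hη) (abs_nonneg _)
    simp only [Finset.sum_const, Finset.card_univ, Fintype.card_fin, nsmul_eq_mul] at h1
    linarith
  have t4' : h ^ 2 / 2 * (‖∑ i, (L i)⁻¹ • σ • x i‖ ^ 2 - k) ≤
      h ^ 2 / 2 * (4 * k * β + 2 * S + 10 * η * (-2 * σ * S + 2 * M * w * k ^ 2)) := by
    refine mul_le_mul_of_nonneg_left (t4.trans (add_le_add le_rfl ?_)) (by positivity)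
    exact mul_le_mul_of_nonneg_left hAle (by positivity)
  have t5 : 10 * h * |lam| * w * η * (N + A) ≤
      10 * h * |lam| * w * η * (2 * k + (-2 * σ * S + 2 * M * w * k ^ 2)) :=
    mul_le_mul_of_nonneg_left (add_le_add hN3 hAle) (by positivity)
  have t6 : -σ * h * lam * w * N ≤ -σ * h * lam * w * k + h * |lam| * w * k * δ := by
    have h1 : -σ * h * lam * w * (N - k) ≤ |-σ * h * lam * w * (N - k)| := le_abs_self _
    rw [abs_mul, abs_mul, abs_mul, abs_mul, abs_neg, hσa, abs_of_nonneg hh, abs_of_pos hw] at h1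
    have h2 : 1 * h * |lam| * w * |N - k| ≤ 1 * h * |lam| * w * (k * δ) := by gcongr
    linarith
  linarith

end Exponent

/-! ### Integrating out one vector -/

section Step

/-- The smallness assumptions relating the scale `w = 1 / √d`, the ratio `η = ℓ / √d`, the norm
window `δ` and the number `R` of vectors; `h` is the slope of `log Φ` at `-c` and `q = Φ(-c)`. -/
structure SmallRegime (M h c w η δ q R : ℝ) : Prop where
  one_le_M : 1 ≤ M
  h_nonneg : 0 ≤ h
  h_le : h ≤ M
  c_le : |c| ≤ M
  w_pos : 0 < w
  w_le : w ≤ η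
  δ_nonneg : 0 ≤ δ
  δ_le : δ ≤ η
  δ_sq_le : δ ^ 2 ≤ 9 * M ^ 2 * w
  η_le : η * (100 * M ^ 6) ≤ 1
  one_le_R : 1 ≤ R
  R_mul_le : R * w ≤ M * η
  q_nonneg : 0 ≤ q
  tangent : ∀ u, (gaussianReal 0 1).real (Set.Iic u) ≤ q * Real.exp (h * (u - -c))

variable {E : Type*} [NormedAddCommGroup E] [InnerProductSpace ℝ E]

/-- Cliques (of the colour `σ = ±1`) with norms close to one and with small projections onto the
spans of the preceding vectors. -/
structure GoodSeq (σ c w δ β : ℝ) {k : ℕ} (x : Fin k → E) : Prop where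
  clique : ∀ i j, i ≠ j → σ * ⟪x i, x j⟫ ≤ -c * w
  norm_window : ∀ i, |‖x i‖ ^ 2 - 1| ≤ δ
  projection : ∀ i, ∀ a : Fin k → ℝ, |⟪x i, ∑ j, (if j < i then a j else 0) • x j⟫| ≤
    β * ‖∑ j, (if j < i then a j else 0) • x j‖

variable {σ c w δ β : ℝ} {k : ℕ}

/-- The component of `x i` in the span of the preceding vectors. -/
noncomputable def prefixProj [FiniteDimensional ℝ E] (x : Fin k → E) (i : Fin k) : E :=
  (Submodule.span ℝ (x '' {j | j < i})).starProjection (x i)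

theorem inner_sub_prefixProj_of_mem [FiniteDimensional ℝ E] (x : Fin k → E) (i : Fin k) {v : E}
    (hv : v ∈ Submodule.span ℝ (x '' {j | j < i})) : ⟪x i - prefixProj x i, v⟫ = 0 :=
  Submodule.starProjection_inner_eq_zero _ _ hv

theorem mem_span_prefix_iff (x : Fin k → E) (i : Fin k) (v : E) :
    v ∈ Submodule.span ℝ (x '' {j | j < i}) ↔
      ∃ a : Fin k → ℝ, ∑ j, (if j < i then a j else 0) • x j = v := by
  have h : x '' {j | j < i} = x '' ((Finset.univ.filter (· < i) : Finset (Fin k)) : Set _) := by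
    simp
  rw [h, Submodule.mem_span_image_finset_iff_exists_fun']
  simp only [Finset.sum_filter, ite_smul, zero_smul]

variable [FiniteDimensional ℝ E]

theorem inner_sub_prefixProj (x : Fin k → E) {i j : Fin k} (hj : j < i) :
    ⟪x i - prefixProj x i, x j⟫ = 0 :=
  inner_sub_prefixProj_of_mem x i (Submodule.subset_span ⟨j, hj, rfl⟩)

theorem prefixProj_mem (x : Fin k → E) (i : Fin k) :
    prefixProj x i ∈ Submodule.span ℝ (x '' {j | j < i}) :=
  Submodule.starProjection_apply_mem _ _

theorem norm_sub_prefixProj_sq (x : Fin k → E) (i : Fin k) :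
    ‖x i - prefixProj x i‖ ^ 2 = ‖x i‖ ^ 2 - ‖prefixProj x i‖ ^ 2 := by
  have h := inner_sub_prefixProj_of_mem x i (prefixProj_mem x i)
  have h2 : ‖x i‖ ^ 2 = ‖(x i - prefixProj x i) + prefixProj x i‖ ^ 2 := by rw [sub_add_cancel]
  rw [h2, norm_add_sq_real, h]
  ring

/-- The projection inequality is tested on the projection itself. -/
theorem GoodSeq.norm_prefixProj_le {x : Fin k → E} (hx : GoodSeq σ c w δ β x) (hβ : 0 ≤ β)
    (i : Fin k) : ‖prefixProj x i‖ ≤ β := by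
  obtain ⟨a, ha⟩ := (mem_span_prefix_iff x i _).1 (prefixProj_mem x i)
  have h1 := hx.projection i a
  rw [ha] at h1
  have h2 := inner_sub_prefixProj_of_mem x i (prefixProj_mem x i)
  rw [inner_sub_left, sub_eq_zero, real_inner_self_eq_norm_sq] at h2
  rw [h2, abs_of_nonneg (sq_nonneg _), sq] at h1
  rcases (norm_nonneg (prefixProj x i)).eq_or_lt with h0 | h0
  · rw [← h0]; exact hβ
  · exact le_of_mul_le_mul_right h1 h0

/-- Everything in the bound on the integral over one vector that does not depend on the
quadratic tilt. -/
noncomputable def stepExponent (σ h c w M η δ β lam : ℝ) (x : Fin k → E) : ℝ :=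
  -σ * h * lam * w * k + ∑ i, normPotential M h c (‖x i‖ ^ 2 - 1) +
    (2 * lam ^ 2 * w ^ 2 - 2 * h * σ * lam * w - 20 * σ * h * |lam| * w * η + h ^ 2 -
      10 * σ * h ^ 2 * η) * pairSum x +
    (h * |lam| * w * k * δ + 20 * h * |lam| * w * η * k + 20 * h * |lam| * w * η * M * w * k ^ 2 +
      5 * k * M ^ 2 * β ^ 2 + 2 * k * lam ^ 2 * w ^ 2 + 2 * h ^ 2 * k * β ^ 2 +
      10 * h ^ 2 * η * M * w * k ^ 2)

variable [MeasurableSpace E] [BorelSpace E]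

/-- The tilt by θ changes the variance by the factor κ² = 1/(1 - 2θw²). As ‖g‖² has mean 1, the
normalisation costs only the second-order term 2θ²w²; the rescaled thresholds cost the term linear
in |θ|. -/
theorem lintegral_tilted_clique_le {M h η q R θ lam : ℝ} (hr : SmallRegime M h c w η δ q R)
    (hσ : σ = 1 ∨ σ = -1) (hβ0 : 0 ≤ β) (hβ : β ^ 2 ≤ M ^ 2 * η * w)
    (hd : (Module.finrank ℝ E : ℝ) * w ^ 2 = 1) (hθ : 2 * |θ| * w ^ 2 ≤ 4 * η)
    {x : Fin k → E} (hx : GoodSeq σ c w δ β x) :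
    ∫⁻ g, ENNReal.ofReal (Real.exp (⟪lam • ∑ i, x i, g⟫ + θ * (‖g‖ ^ 2 - 1))) *
        {g : E | ∀ i, ⟪σ • x i, g⟫ ≤ -c * w}.indicator 1 g ∂((stdGaussian E).map (w • ·)) ≤
      ENNReal.ofReal (q ^ k * Real.exp (stepExponent σ h c w M η δ β lam x +
        (2 * θ ^ 2 * w ^ 2 + 4 * k * M ^ 2 * |θ| * w ^ 2))) := by
  have hM := hr.one_le_M
  have hw := hr.w_pos
  have hη0 : 0 ≤ η := hw.le.trans hr.w_le
  have hM6 : 1 ≤ M ^ 6 := one_le_pow₀ hM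
  have hηs : η ≤ 1 / 100 := by nlinarith [hr.η_le]
  have hσa : |σ| = 1 := by rcases hσ with h | h <;> rw [h] <;> norm_num
  have hβη : β ^ 2 ≤ η := by
    have h1 : M ^ 2 * w ≤ M ^ 6 * η :=
      mul_le_mul (pow_le_pow_right₀ hM (by norm_num)) hr.w_le hw.le (by positivity)
    have h2 : M ^ 2 * w ≤ 1 := by linarith [hr.η_le]
    nlinarith
  set χ := 2 * θ * w ^ 2 with hχdef
  have hχa : |χ| = 2 * |θ| * w ^ 2 := by
    rw [hχdef, abs_mul, abs_mul, abs_of_nonneg (sq_nonneg w)]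
    norm_num
  have hχη : |χ| ≤ 4 * η := hχa.trans_le hθ
  have hχs : |χ| ≤ 1 / 2 := by linarith
  have hχ1 : 0 < 1 - χ := by linarith [(abs_le.1 hχs).2]
  set κ := (√(1 - χ))⁻¹ with hκdef
  have hκ : 0 < κ := inv_pos.2 (Real.sqrt_pos.2 hχ1)
  have hκχ : χ = 1 - (κ ^ 2)⁻¹ := by
    rw [hκdef, inv_pow, inv_inv, Real.sq_sqrt hχ1.le]
    ring
  set L : Fin k → ℝ := fun i => ‖x i - prefixProj x i‖ with hL
  have hLsq : ∀ i, L i ^ 2 = ‖x i‖ ^ 2 - ‖prefixProj x i‖ ^ 2 := norm_sub_prefixProj_sq x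
  have hb : ∀ i, ‖prefixProj x i‖ ^ 2 ≤ β ^ 2 := fun i =>
    pow_le_pow_left₀ (norm_nonneg _) (hx.norm_prefixProj_le hβ0 i) 2
  have hLpos : ∀ i, 0 < L i := fun i => by
    have := (abs_inv_sub_one_le (s := ‖x i‖ ^ 2 - 1) (norm_nonneg _)
      ((hLsq i).trans (by ring)) ((hx.norm_window i).trans hr.δ_le) (sq_nonneg _)
      ((hb i).trans hβη) (by linarith)).1
    simp only [hL]
    linarith
  have hLσ : ∀ i, ‖σ • x i - σ • prefixProj x i‖ = L i := fun i => by
    rw [← smul_sub, norm_smul, Real.norm_eq_abs, hσa, one_mul]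
  have h1 := lintegral_tilted_orthant_le hr.q_nonneg hw hκ hκχ hr.tangent
    (fun i => σ • x i) (fun i => σ • prefixProj x i) (lam • ∑ i, x i)
    (fun i j hij => by
      rw [← smul_sub, real_inner_smul_left, real_inner_smul_right, inner_sub_prefixProj x hij]
      simp)
    (fun i => by
      rw [← smul_sub, real_inner_smul_left, real_inner_smul_right,
        inner_sub_prefixProj_of_mem x i (prefixProj_mem x i)]
      simp)
    (fun i => by rw [hLσ]; exact hLpos i)
  refine h1.trans (ENNReal.ofReal_le_ofReal ?_)
  simp_rw [hLσ]
  have h2 := orthant_exponent_le (lam := lam) hσ hr.h_nonneg hr.h_le hr.c_le hw (by linarith)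
    hr.δ_le hβη hx.clique hx.norm_window (fun i => (hLpos i).le) hLsq (fun i => sq_nonneg _) hb
    hκ hκχ hχη
  have h3 := exp_neg_mul_pow_le hd hκχ hχs
  calc _ ≤ Real.exp (2 * θ ^ 2 * w ^ 2) * q ^ k *
        Real.exp (stepExponent σ h c w M η δ β lam x + 4 * k * M ^ 2 * |θ| * w ^ 2) := by
        refine mul_le_mul (mul_le_mul_of_nonneg_right h3 (pow_nonneg hr.q_nonneg k))
          (Real.exp_le_exp.2 (h2.trans_eq ?_)) (Real.exp_pos _).le
          (mul_nonneg (Real.exp_pos _).le (pow_nonneg hr.q_nonneg k))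
        rw [hχa, stepExponent]
        ring
    _ = _ := by
        rw [mul_comm (Real.exp _) (q ^ k), mul_assoc, ← Real.exp_add]
        congr 2
        ring

end Step

/-! ### Evolution of the tilt and the error of one integration step -/

section Iteration

variable {E : Type*} [NormedAddCommGroup E] [InnerProductSpace ℝ E]
variable {σ c w δ β : ℝ} {k : ℕ}

/-- The coefficient of the sum of the pairwise inner products after integrating out a vector. -/
noncomputable def nextTilt (σ h w η lam : ℝ) : ℝ :=
  lam + (2 * lam ^ 2 * w ^ 2 - 2 * h * σ * lam * w - 20 * σ * h * |lam| * w * η + h ^ 2 -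
    10 * σ * h ^ 2 * η)

theorem abs_tilt_le {M h η q R lam : ℝ} {n : ℕ} (hr : SmallRegime M h c w η δ q R)
    (hn : (n : ℝ) ≤ R) (hlam : |lam - n * h ^ 2| ≤ 26 * M ^ 6 * n * η) :
    |lam| ≤ 2 * M ^ 2 * R := by
  have hM := hr.one_le_M
  have hn0 : (0 : ℝ) ≤ n := Nat.cast_nonneg n
  have h1 : |lam| ≤ 26 * M ^ 6 * n * η + n * h ^ 2 := by
    have := abs_sub_abs_le_abs_sub lam (n * h ^ 2)
    rw [abs_of_nonneg (by positivity : 0 ≤ n * h ^ 2)] at this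
    linarith
  have h2 : n * h ^ 2 ≤ R * M ^ 2 :=
    mul_le_mul hn (pow_le_pow_left₀ hr.h_nonneg hr.h_le 2) (sq_nonneg _) (hn0.trans hn)
  have h3 : 26 * M ^ 6 * n * η ≤ R * M ^ 2 := by
    have h4 : 26 * M ^ 6 * η ≤ 1 := by
      have := hr.η_le
      have : 0 ≤ η * M ^ 6 := mul_nonneg (hr.w_pos.le.trans hr.w_le) (by positivity)
      linarith
    calc 26 * M ^ 6 * n * η = (n : ℝ) * (26 * M ^ 6 * η) := by ring
      _ ≤ (n : ℝ) * 1 := mul_le_mul_of_nonneg_left h4 hn0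
      _ ≤ R * M ^ 2 := mul_le_mul hn (one_le_pow₀ hM) zero_le_one (hn0.trans hn)
  linarith

/-- The invariant of the iteration: a step adds h² up to four corrections, bounded by 1, 4, 1 and 10
times M⁶η, since |lam| w ≤ 2M³η. -/
theorem abs_nextTilt_sub_le {M h η q R lam : ℝ} {n : ℕ} (hr : SmallRegime M h c w η δ q R)
    (hσ : σ = 1 ∨ σ = -1) (hn : (n : ℝ) ≤ R) (hlam : |lam - n * h ^ 2| ≤ 26 * M ^ 6 * n * η) :
    |nextTilt σ h w η lam - (n + 1 : ℕ) * h ^ 2| ≤ 26 * M ^ 6 * (n + 1 : ℕ) * η := by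
  have hM := hr.one_le_M
  have hw := hr.w_pos
  have hη0 : 0 ≤ η := hw.le.trans hr.w_le
  have hlam2 := abs_tilt_le hr hn hlam
  have hσa : |σ| = 1 := by rcases hσ with h | h <;> rw [h] <;> norm_num
  have hM6 : 1 ≤ M ^ 6 := one_le_pow₀ hM
  have hηs : η ≤ 1 / 100 := by nlinarith [hr.η_le]
  have hlw : |lam| * w ≤ 2 * M ^ 3 * η := by
    calc |lam| * w ≤ 2 * M ^ 2 * R * w := mul_le_mul_of_nonneg_right hlam2 hw.le
      _ = 2 * M ^ 2 * (R * w) := by ring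
      _ ≤ 2 * M ^ 2 * (M * η) := mul_le_mul_of_nonneg_left hr.R_mul_le (by positivity)
      _ = _ := by ring
  have hlw0 : 0 ≤ |lam| * w := by positivity
  have p2 : M ^ 2 ≤ M ^ 6 := pow_le_pow_right₀ hM (by norm_num)
  have p4 : M ^ 4 ≤ M ^ 6 := pow_le_pow_right₀ hM (by norm_num)
  have b1 : |2 * lam ^ 2 * w ^ 2| ≤ M ^ 6 * η := by
    have e : |2 * lam ^ 2 * w ^ 2| = 2 * (|lam| * w) ^ 2 := by
      rw [abs_of_nonneg (by positivity), mul_pow, sq_abs]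
      ring
    rw [e]
    calc 2 * (|lam| * w) ^ 2 ≤ 2 * (2 * M ^ 3 * η) ^ 2 := by gcongr
      _ = 8 * η * (M ^ 6 * η) := by ring
      _ ≤ 1 * (M ^ 6 * η) := mul_le_mul_of_nonneg_right (by linarith) (by positivity)
      _ = _ := one_mul _
  have b2 : |2 * h * σ * lam * w| ≤ 4 * M ^ 6 * η := by
    have e : |2 * h * σ * lam * w| = 2 * h * (|lam| * w) := by
      rw [abs_mul, abs_mul, abs_mul, abs_mul, hσa, abs_of_pos hw, abs_of_nonneg hr.h_nonneg, abs_two]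
      ring
    rw [e]
    calc 2 * h * (|lam| * w) ≤ 2 * M * (2 * M ^ 3 * η) := by
          have := hr.h_le
          have := hr.h_nonneg
          gcongr
      _ = 4 * M ^ 4 * η := by ring
      _ ≤ _ := by gcongr
  have b3 : |20 * σ * h * |lam| * w * η| ≤ M ^ 6 * η := by
    have e : |20 * σ * h * |lam| * w * η| = 20 * η * h * (|lam| * w) := by
      rw [abs_mul, abs_mul, abs_mul, abs_mul, abs_mul, hσa, abs_of_pos hw,
        abs_of_nonneg hr.h_nonneg, abs_abs, abs_of_nonneg hη0, abs_of_pos (by norm_num)]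
      ring
    rw [e]
    calc 20 * η * h * (|lam| * w) ≤ 20 * η * M * (2 * M ^ 3 * η) := by
          have := hr.h_le
          have := hr.h_nonneg
          gcongr
      _ = 40 * η * (M ^ 4 * η) := by ring
      _ ≤ 1 * (M ^ 6 * η) := by
          gcongr
          linarith
      _ = _ := one_mul _
  have b4 : |10 * σ * h ^ 2 * η| ≤ 10 * M ^ 6 * η := by
    have e : |10 * σ * h ^ 2 * η| = 10 * h ^ 2 * η := by
      rw [abs_mul, abs_mul, abs_mul, hσa, abs_of_nonneg hη0, abs_of_nonneg (sq_nonneg h),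
        abs_of_pos (by norm_num)]
      ring
    rw [e]
    have := hr.h_le
    have := hr.h_nonneg
    calc 10 * h ^ 2 * η ≤ 10 * M ^ 2 * η := by gcongr
      _ ≤ _ := by gcongr
  have hpos : 0 ≤ M ^ 6 * η := by positivity
  rw [nextTilt]
  push_cast
  rw [abs_le] at *
  constructor <;> linarith

/-- Every error is measured against R² w η. The constant is 133 = 2 + 40 + 40 + 5 + 8 + 2 + 10 + 26,
the last summand being the cost of replacing lam by n h² in the main term. -/
theorem stepExponent_le {E : Type*} [NormedAddCommGroup E] {M h η q R lam : ℝ} {n : ℕ} (hr : SmallRegime M h c w η δ q R)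
    (hσ : σ = 1 ∨ σ = -1) (hβ : β ^ 2 ≤ M ^ 2 * η * w) (hkn : (k : ℝ) + n ≤ R)
    (hlam : |lam - n * h ^ 2| ≤ 26 * M ^ 6 * n * η) (x : Fin k → E) :
    stepExponent σ h c w M η δ β lam x ≤ -σ * h ^ 3 * w * (n * k) +
      133 * M ^ 7 * (R ^ 2 * w * η) + ∑ i, normPotential M h c (‖x i‖ ^ 2 - 1) +
      (nextTilt σ h w η lam - lam) * pairSum x := by
  have hM := hr.one_le_M
  have hw := hr.w_pos
  have hη0 : 0 ≤ η := hw.le.trans hr.w_le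
  have hh := hr.h_nonneg
  have hhM := hr.h_le
  have hδ0 := hr.δ_nonneg
  have hδ := hr.δ_le
  have hR := hr.one_le_R
  have hRw := hr.R_mul_le
  have hn0 : (0 : ℝ) ≤ n := Nat.cast_nonneg n
  have hk0 : (0 : ℝ) ≤ k := Nat.cast_nonneg k
  have hnR : (n : ℝ) ≤ R := by linarith
  have hkR : (k : ℝ) ≤ R := by linarith
  have hlam2 := abs_tilt_le hr hnR hlam
  have hσa : |σ| = 1 := by rcases hσ with h | h <;> rw [h] <;> norm_num
  have hM6 : 1 ≤ M ^ 6 := one_le_pow₀ hM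
  have hηs : η ≤ 1 / 100 := by nlinarith [hr.η_le]
  have hl0 := abs_nonneg lam
  have hRR : R ≤ R ^ 2 := by nlinarith
  set Q := R ^ 2 * w * η with hQ
  have hQ0 : 0 ≤ Q := by positivity
  have pw : ∀ m ≤ 7, M ^ m * Q ≤ M ^ 7 * Q := fun m hm =>
    mul_le_mul_of_nonneg_right (pow_le_pow_right₀ hM hm) hQ0
  have t1 : h * |lam| * w * k * δ ≤ 2 * (M ^ 3 * Q) := by
    calc _ ≤ M * (2 * M ^ 2 * R) * w * R * η := by gcongr
      _ = _ := by ring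
  have t2 : 20 * h * |lam| * w * η * k ≤ 40 * (M ^ 3 * Q) := by
    calc _ ≤ 20 * M * (2 * M ^ 2 * R) * w * η * R := by gcongr
      _ = _ := by ring
  have t3 : 20 * h * |lam| * w * η * M * w * k ^ 2 ≤ 40 * (M ^ 5 * Q) := by
    calc _ ≤ 20 * M * (2 * M ^ 2 * R) * w * η * M * w * R ^ 2 := by gcongr
      _ = 40 * M ^ 4 * Q * (R * w) := by ring
      _ ≤ 40 * M ^ 4 * Q * (M * η) := by gcongr
      _ ≤ 40 * M ^ 4 * Q * (M * 1) := by
        gcongr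
        linarith
      _ = _ := by ring
  have t4 : 5 * k * M ^ 2 * β ^ 2 ≤ 5 * (M ^ 4 * Q) := by
    calc _ ≤ 5 * R ^ 2 * M ^ 2 * (M ^ 2 * η * w) := by
          gcongr
          linarith
      _ = _ := by ring
  have t5 : 2 * k * lam ^ 2 * w ^ 2 ≤ 8 * (M ^ 5 * Q) := by
    rw [← sq_abs lam]
    calc _ ≤ 2 * R * (2 * M ^ 2 * R) ^ 2 * w ^ 2 := by gcongr
      _ = 8 * M ^ 4 * R ^ 2 * w * (R * w) := by ring
      _ ≤ 8 * M ^ 4 * R ^ 2 * w * (M * η) := by gcongr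
      _ = _ := by ring
  have t6 : 2 * h ^ 2 * k * β ^ 2 ≤ 2 * (M ^ 4 * Q) := by
    calc _ ≤ 2 * M ^ 2 * R ^ 2 * (M ^ 2 * η * w) := by
          gcongr
          linarith
      _ = _ := by ring
  have t7 : 10 * h ^ 2 * η * M * w * k ^ 2 ≤ 10 * (M ^ 3 * Q) := by
    calc _ ≤ 10 * M ^ 2 * η * M * w * R ^ 2 := by gcongr
      _ = _ := by ring
  have t8 : -σ * h * lam * w * k ≤ -σ * h ^ 3 * w * (n * k) + 26 * (M ^ 7 * Q) := by
    have e : -σ * h * lam * w * k = -σ * h ^ 3 * w * (n * k) +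
        -σ * h * (lam - n * h ^ 2) * w * k := by ring
    rw [e]
    refine add_le_add le_rfl ((le_abs_self _).trans ?_)
    rw [abs_mul, abs_mul, abs_mul, abs_mul, abs_neg, hσa, abs_of_nonneg hh, abs_of_pos hw,
      abs_of_nonneg hk0]
    calc 1 * h * |lam - n * h ^ 2| * w * k ≤ 1 * M * (26 * M ^ 6 * R * η) * w * R := by
          gcongr
          exact hlam.trans (by gcongr)
      _ = _ := by ring
  have := pw 3 (by norm_num)
  have := pw 4 (by norm_num)
  have := pw 5 (by norm_num)
  rw [stepExponent, nextTilt]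
  linarith

variable [FiniteDimensional ℝ E] [MeasurableSpace E] [BorelSpace E]

/-- The constant in the error term of each integration step. -/
noncomputable def stepConst (M : ℝ) : ℝ := 133 * M ^ 7 + (3 * M ^ 4 + 32 * M ^ 2 * Real.exp 9)

set_option maxHeartbeats 1000000 in
-- By `exp_normPotential_le` the integral splits into tilts θ and θ ± 1/w. The central one needs an
-- error O(R² w η) in the exponent; the side ones carry a prefactor of order n w² ≤ R² w η, so a
-- bounded factor suffices for them.
theorem lintegral_step_le {M h η q R lam : ℝ} {n : ℕ} (hr : SmallRegime M h c w η δ q R)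
    (hσ : σ = 1 ∨ σ = -1) (hβ0 : 0 ≤ β) (hβ : β ^ 2 ≤ M ^ 2 * η * w)
    (hd : (Module.finrank ℝ E : ℝ) * w ^ 2 = 1) (hkn : (k : ℝ) + n ≤ R)
    (hlam : |lam - n * h ^ 2| ≤ 26 * M ^ 6 * n * η) {x : Fin k → E}
    (hx : GoodSeq σ c w δ β x) :
    ∫⁻ g, ENNReal.ofReal (Real.exp (⟪lam • ∑ i, x i, g⟫ +
        n * normPotential M h c (‖g‖ ^ 2 - 1))) *
        {g : E | (∀ i, ⟪σ • x i, g⟫ ≤ -c * w) ∧ |‖g‖ ^ 2 - 1| ≤ δ}.indicator 1 g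
        ∂((stdGaussian E).map (w • ·)) ≤
      ENNReal.ofReal (q ^ k * Real.exp (-σ * h ^ 3 * w * (n * k) +
        stepConst M * (R ^ 2 * w * η) + ∑ i, normPotential M h c (‖x i‖ ^ 2 - 1) +
        (nextTilt σ h w η lam - lam) * pairSum x)) := by
  have hM := hr.one_le_M
  have hw := hr.w_pos
  have hη0 : 0 ≤ η := hw.le.trans hr.w_le
  have hwη := hr.w_le
  have hh := hr.h_nonneg
  have hhM := hr.h_le
  have hR := hr.one_le_R
  have hRw := hr.R_mul_le
  have hn0 : (0 : ℝ) ≤ n := Nat.cast_nonneg n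
  have hk0 : (0 : ℝ) ≤ k := Nat.cast_nonneg k
  have hnR : (n : ℝ) ≤ R := by linarith
  have hkR : (k : ℝ) ≤ R := by linarith
  have hηM : ∀ m ≤ 6, 100 * (M ^ m * η) ≤ 1 := fun m hm => by
    have h1 : M ^ m * η ≤ M ^ 6 * η :=
      mul_le_mul_of_nonneg_right (pow_le_pow_right₀ hM hm) hη0
    linarith [hr.η_le]
  have hnw : n * w ≤ M * η := (mul_le_mul_of_nonneg_right hnR hw.le).trans hRw
  set θ := n * (h * c / 2) with hθ
  have hθa : |θ| ≤ n * M ^ 2 / 2 := by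
    rw [hθ, abs_mul, abs_div, abs_mul, abs_of_nonneg hn0, abs_of_nonneg hh, abs_two]
    have h1 : h * |c| ≤ M * M := mul_le_mul hhM hr.c_le (abs_nonneg _) (by linarith)
    calc n * (h * |c| / 2) ≤ n * (M * M / 2) := by gcongr
      _ = _ := by ring
  have hθw : |θ| * w ≤ M ^ 3 * η / 2 := by
    calc |θ| * w ≤ n * M ^ 2 / 2 * w := mul_le_mul_of_nonneg_right hθa hw.le
      _ = M ^ 2 / 2 * (n * w) := by ring
      _ ≤ M ^ 2 / 2 * (M * η) := by gcongr
      _ = _ := by ring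
  set base := stepExponent σ h c w M η δ β lam x with hbase
  set A : Set E := {g : E | ∀ i, ⟪σ • x i, g⟫ ≤ -c * w} with hA
  have hAm : MeasurableSet A := measurableSet_orthant _ _
  set T : ℝ → E → ENNReal := fun ϑ g =>
    ENNReal.ofReal (Real.exp (⟪lam • ∑ i, x i, g⟫ + ϑ * (‖g‖ ^ 2 - 1))) * A.indicator 1 g with hT
  have hTm : ∀ ϑ, Measurable (T ϑ) := fun ϑ => by
    exact Measurable.mul (by fun_prop) (measurable_one.indicator hAm)
  set Q := R ^ 2 * w * η with hQ
  -- the three tilts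
  have hT0 : ∫⁻ g, T θ g ∂((stdGaussian E).map (w • ·)) ≤
      ENNReal.ofReal (q ^ k * Real.exp (base + 3 * M ^ 4 * Q)) := by
    refine (lintegral_tilted_clique_le hr hσ hβ0 hβ hd ?_ hx).trans (ENNReal.ofReal_le_ofReal ?_)
    · have h1 : |θ| * w * w ≤ M ^ 3 * η / 2 * w := mul_le_mul_of_nonneg_right hθw hw.le
      have h2 : M ^ 3 * η / 2 * w ≤ 1 * w :=
        mul_le_mul_of_nonneg_right (by linarith [hηM 3 (by norm_num)]) hw.le
      nlinarith
    · refine mul_le_mul_of_nonneg_left (Real.exp_le_exp.2 (add_le_add le_rfl ?_))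
        (pow_nonneg hr.q_nonneg k)
      have h1 : 2 * θ ^ 2 * w ^ 2 ≤ M ^ 4 * Q := by
        rw [← sq_abs θ]
        calc 2 * |θ| ^ 2 * w ^ 2 ≤ 2 * (n * M ^ 2 / 2) ^ 2 * w ^ 2 := by gcongr
          _ = M ^ 4 * (n ^ 2 * w * w) / 2 := by ring
          _ ≤ M ^ 4 * (R ^ 2 * w * η) / 2 := by gcongr
          _ ≤ M ^ 4 * Q := by
            rw [← hQ]
            have : 0 ≤ M ^ 4 * Q := by positivity
            linarith
      have h2 : 4 * k * M ^ 2 * |θ| * w ^ 2 ≤ 2 * (M ^ 4 * Q) := by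
        calc 4 * k * M ^ 2 * |θ| * w ^ 2 ≤ 4 * R * M ^ 2 * (R * M ^ 2 / 2) * w ^ 2 := by
              gcongr
              exact hθa.trans (by gcongr)
          _ = 2 * M ^ 4 * (R ^ 2 * w * w) := by ring
          _ ≤ 2 * M ^ 4 * (R ^ 2 * w * η) := by gcongr
          _ = _ := by ring
      linarith
  -- The 9 is 8 + 1: |ϑ| w ≤ 2 bounds the normalisation term by 8, and the threshold term is at most
  -- 1.
  have hT1 : ∀ ϑ : ℝ, |ϑ| ≤ |θ| + w⁻¹ → ∫⁻ g, T ϑ g ∂((stdGaussian E).map (w • ·)) ≤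
      ENNReal.ofReal (q ^ k * Real.exp (base + 9)) := by
    intro ϑ hϑ
    have h0 : |ϑ| * w ≤ 2 := by
      calc |ϑ| * w ≤ (|θ| + w⁻¹) * w := mul_le_mul_of_nonneg_right hϑ hw.le
        _ = |θ| * w + 1 := by rw [add_mul, inv_mul_cancel₀ hw.ne']
        _ ≤ 2 := by linarith [hηM 3 (by norm_num)]
    refine (lintegral_tilted_clique_le hr hσ hβ0 hβ hd ?_ hx).trans (ENNReal.ofReal_le_ofReal ?_)
    · have := mul_le_mul_of_nonneg_right h0 hw.le
      nlinarith
    · refine mul_le_mul_of_nonneg_left (Real.exp_le_exp.2 (add_le_add le_rfl ?_))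
        (pow_nonneg hr.q_nonneg k)
      have h1 : 2 * ϑ ^ 2 * w ^ 2 ≤ 8 := by
        rw [← sq_abs ϑ]
        have : (|ϑ| * w) ^ 2 ≤ 2 ^ 2 := pow_le_pow_left₀ (by positivity) h0 2
        nlinarith
      have h2 : 4 * k * M ^ 2 * |ϑ| * w ^ 2 ≤ 1 := by
        calc 4 * k * M ^ 2 * |ϑ| * w ^ 2 = 4 * M ^ 2 * (k * w) * (|ϑ| * w) := by ring
          _ ≤ 4 * M ^ 2 * (R * w) * 2 := by gcongr
          _ ≤ 4 * M ^ 2 * (M * η) * 2 := by gcongr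
          _ = 8 * (M ^ 3 * η) := by ring
          _ ≤ 1 := by linarith [hηM 3 (by norm_num), mul_nonneg (pow_nonneg (by linarith : 0 ≤ M) 3) hη0]
      linarith
  -- splitting the potential
  set W := 16 * M ^ 2 * n * w ^ 2 with hW
  have hW0 : 0 ≤ W := by positivity
  have hpt : ∀ g : E, ENNReal.ofReal (Real.exp (⟪lam • ∑ i, x i, g⟫ +
        n * normPotential M h c (‖g‖ ^ 2 - 1))) *
        {g : E | (∀ i, ⟪σ • x i, g⟫ ≤ -c * w) ∧ |‖g‖ ^ 2 - 1| ≤ δ}.indicator 1 g ≤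
      T θ g + ENNReal.ofReal W * T (θ + w⁻¹) g + ENNReal.ofReal W * T (θ - w⁻¹) g := by
    intro g
    by_cases hg : g ∈ {g : E | (∀ i, ⟪σ • x i, g⟫ ≤ -c * w) ∧ |‖g‖ ^ 2 - 1| ≤ δ}
    · have hgA : g ∈ A := hg.1
      rw [Set.indicator_of_mem hg]
      simp only [hT, Set.indicator_of_mem hgA, Pi.one_apply, mul_one]
      rw [← ENNReal.ofReal_mul hW0, ← ENNReal.ofReal_mul hW0,
        ← ENNReal.ofReal_add (by positivity) (by positivity),
        ← ENNReal.ofReal_add (by positivity) (by positivity)]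
      refine ENNReal.ofReal_le_ofReal ?_
      set s := ‖g‖ ^ 2 - 1 with hs
      have hs2 : s ^ 2 ≤ 9 * M ^ 2 * w := by
        rw [← sq_abs]
        exact (pow_le_pow_left₀ (abs_nonneg _) hg.2 2).trans hr.δ_sq_le
      -- The only use of the sharp norm window: δ² is of order w, so n s² stays bounded although n
      -- itself is large.
      have h1 : n * (4 * M ^ 2 * s ^ 2) ≤ 1 := by
        calc n * (4 * M ^ 2 * s ^ 2) ≤ n * (4 * M ^ 2 * (9 * M ^ 2 * w)) := by gcongr
          _ = 36 * M ^ 4 * (n * w) := by ring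
          _ ≤ 36 * M ^ 4 * (M * η) := by gcongr
          _ = 36 * (M ^ 5 * η) := by ring
          _ ≤ 1 := by linarith [hηM 5 (by norm_num), mul_nonneg (pow_nonneg (by linarith : 0 ≤ M) 5) hη0]
      have h2 := exp_normPotential_le (M := M) (h := h) (c := c) hw hn0 h1
      simp only [Real.exp_add ⟪lam • ∑ i, x i, g⟫]
      have h3 := mul_le_mul_of_nonneg_left h2 (Real.exp_pos ⟪lam • ∑ i, x i, g⟫).le
      rw [← hθ, ← hW] at h3
      linarith
    · rw [Set.indicator_of_notMem hg, mul_zero]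
      exact zero_le
  refine (lintegral_mono hpt).trans ?_
  rw [lintegral_add_right _ ((hTm _).const_mul _), lintegral_add_right _ ((hTm _).const_mul _),
    lintegral_const_mul _ (hTm _), lintegral_const_mul _ (hTm _)]
  have hadd : |θ + w⁻¹| ≤ |θ| + w⁻¹ := by
    simpa [abs_of_pos (inv_pos.2 hw)] using abs_add_le θ w⁻¹
  have hsub : |θ - w⁻¹| ≤ |θ| + w⁻¹ := by
    simpa [abs_of_pos (inv_pos.2 hw)] using abs_sub θ w⁻¹
  refine (add_le_add (add_le_add hT0 (mul_le_mul_right (hT1 _ hadd) _))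
    (mul_le_mul_right (hT1 _ hsub) _)).trans ?_
  have hqk := pow_nonneg hr.q_nonneg k
  rw [← ENNReal.ofReal_mul hW0, ← ENNReal.ofReal_add (by positivity) (by positivity),
    ← ENNReal.ofReal_add (by positivity) (by positivity)]
  refine ENNReal.ofReal_le_ofReal ?_
  have hWQ : 2 * W * Real.exp 9 ≤ 32 * M ^ 2 * Real.exp 9 * Q := by
    have : n * w ^ 2 ≤ Q := by
      calc n * w ^ 2 = n * (w * w) := by ring
        _ ≤ R ^ 2 * (w * η) := by
          gcongr
          nlinarith
        _ = Q := by rw [hQ]; ring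
    calc 2 * W * Real.exp 9 = 32 * M ^ 2 * Real.exp 9 * (n * w ^ 2) := by rw [hW]; ring
      _ ≤ _ := mul_le_mul_of_nonneg_left this (by positivity)
  have hQ0 : 0 ≤ Q := by positivity
  -- For A, B ≥ 0: exp A + B ≤ exp A · (1 + B) ≤ exp(A + B).
  have hexp : Real.exp (3 * M ^ 4 * Q) + 2 * W * Real.exp 9 ≤
      Real.exp ((3 * M ^ 4 + 32 * M ^ 2 * Real.exp 9) * Q) := by
    have h1 : 1 ≤ Real.exp (3 * M ^ 4 * Q) := Real.one_le_exp (by positivity)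
    have h2 := Real.add_one_le_exp (32 * M ^ 2 * Real.exp 9 * Q)
    have h3 : 0 ≤ 32 * M ^ 2 * Real.exp 9 * Q := by positivity
    rw [add_mul, Real.exp_add]
    nlinarith
  have hfin := stepExponent_le hr hσ hβ hkn hlam x
  calc _ = q ^ k * (Real.exp base * (Real.exp (3 * M ^ 4 * Q) + 2 * W * Real.exp 9)) := by
        rw [Real.exp_add, Real.exp_add]
        ring
    _ ≤ q ^ k * (Real.exp base *
        Real.exp ((3 * M ^ 4 + 32 * M ^ 2 * Real.exp 9) * Q)) := by gcongr
    _ = q ^ k * Real.exp (base + (3 * M ^ 4 + 32 * M ^ 2 * Real.exp 9) * Q) := by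
        rw [Real.exp_add]
    _ ≤ _ := by
        refine mul_le_mul_of_nonneg_left (Real.exp_le_exp.2 ?_) hqk
        rw [stepConst, hbase]
        linarith

end Iteration

/-! ### Iterating over all vectors -/

section Induction

theorem pairSum_snoc {E : Type*} [NormedAddCommGroup E] [InnerProductSpace ℝ E] {k : ℕ}
    (x : Fin k → E) (y : E) :
    pairSum (Fin.snoc x y : Fin (k + 1) → E) = pairSum x + ⟪∑ i, x i, y⟫ := by
  simp only [pairSum, Fin.sum_univ_castSucc, Fin.snoc_castSucc, Fin.snoc_last]
  rw [norm_add_sq_real]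
  ring

theorem lintegral_pi_snoc {E : Type*} [MeasurableSpace E] (ν : Measure E) [IsProbabilityMeasure ν] {k : ℕ}
    {F : (Fin (k + 1) → E) → ENNReal} (hF : Measurable F) :
    ∫⁻ x, F x ∂(Measure.pi fun _ => ν) =
      ∫⁻ x, ∫⁻ y, F (Fin.snoc x y) ∂ν ∂(Measure.pi fun _ : Fin k => ν) := by
  have h := (measurePreserving_piFinSuccAbove (fun _ : Fin (k + 1) => ν) (Fin.last k)).symm
  rw [← h.lintegral_comp hF]
  refine (lintegral_prod_symm _ (hF.comp h.measurable).aemeasurable).trans ?_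
  refine lintegral_congr fun x => lintegral_congr fun y => ?_
  simp only [MeasurableEquiv.piFinSuccAbove_symm_apply, Function.comp]
  exact congrArg F (Fin.insertNth_last' y x)

/-- The projection bound on the last vector is dropped: projections matter only for the vectors that
define the orthant. -/
theorem GoodSeq.of_snoc {E : Type*} [NormedAddCommGroup E] [InnerProductSpace ℝ E]
    {σ c w δ β : ℝ} {k : ℕ} {x : Fin k → E} {y : E}
    (h : GoodSeq σ c w δ β (Fin.snoc x y : Fin (k + 1) → E)) :
    GoodSeq σ c w δ β x ∧ (∀ i, ⟪σ • x i, y⟫ ≤ -c * w) ∧ |‖y‖ ^ 2 - 1| ≤ δ := by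
  refine ⟨⟨fun i j hij => ?_, fun i => ?_, fun i a => ?_⟩, fun i => ?_, ?_⟩
  · simpa using h.clique i.castSucc j.castSucc (by simpa using hij)
  · simpa using h.norm_window i.castSucc
  · have := h.projection i.castSucc (Fin.snoc a 0)
    simpa [Fin.sum_univ_castSucc] using this
  · have := h.clique i.castSucc (Fin.last k) (Fin.castSucc_lt_last i).ne
    simpa [real_inner_smul_left] using this
  · simpa using h.norm_window (Fin.last k)

variable {E : Type*} [NormedAddCommGroup E] [InnerProductSpace ℝ E] [FiniteDimensional ℝ E]
  [MeasurableSpace E] [BorelSpace E]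

/-- Testing projections against all linear combinations makes the set an intersection of closed
conditions, uncountable but still closed. The projection onto a varying span is not continuous in x.
-/
theorem measurableSet_goodSeq (σ c w δ β : ℝ) (k : ℕ) :
    MeasurableSet {x : Fin k → E | GoodSeq σ c w δ β x} := by
  have h : {x : Fin k → E | GoodSeq σ c w δ β x} =
      (⋂ i, ⋂ j, ⋂ _ : i ≠ j, {x | σ * ⟪x i, x j⟫ ≤ -c * w}) ∩
      ((⋂ i, {x | |‖x i‖ ^ 2 - 1| ≤ δ}) ∩
      ⋂ i, ⋂ a : Fin k → ℝ, {x | |⟪x i, ∑ j, (if j < i then a j else 0) • x j⟫| ≤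
        β * ‖∑ j, (if j < i then a j else 0) • x j‖}) := by
    ext x
    simp only [Set.mem_inter_iff, Set.mem_iInter, Set.mem_ofPred_eq]
    exact ⟨fun h => ⟨h.1, h.2, h.3⟩, fun h => ⟨h.1, h.2.1, h.2.2⟩⟩
  rw [h]
  refine IsClosed.measurableSet (IsClosed.inter ?_ (IsClosed.inter ?_ ?_))
  · exact isClosed_iInter fun i => isClosed_iInter fun j => isClosed_iInter fun _ =>
      isClosed_le (by fun_prop) (by fun_prop)
  · exact isClosed_iInter fun i => isClosed_le (by fun_prop) (by fun_prop)
  · exact isClosed_iInter fun i => isClosed_iInter fun a =>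
      isClosed_le (by fun_prop) (by fun_prop)

theorem measurable_goodSeq_weight (σ c w δ β M h lam n : ℝ) (k : ℕ) :
    Measurable fun x : Fin k → E => {x | GoodSeq σ c w δ β x}.indicator (1 : (Fin k → E) → ENNReal) x *
      ENNReal.ofReal (Real.exp (lam * pairSum x +
        n * ∑ i, normPotential M h c (‖x i‖ ^ 2 - 1))) := by
  refine Measurable.mul (measurable_one.indicator (measurableSet_goodSeq σ c w δ β k)) ?_
  unfold pairSum normPotential
  fun_prop

/-- Here k vectors remain and n have been integrated out, so n is the multiplicity of the norm
potential and lam ≈ n h². A step passes from (k+1, n) to (k, n+1) and contributes n k; by Pascal's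
rule, n k + C(k,3) + (n+1) C(k,2) = C(k+1,3) + n C(k+1,2). -/
theorem lintegral_goodSeq_le {σ c w δ β M h η q R : ℝ} (hr : SmallRegime M h c w η δ q R)
    (hσ : σ = 1 ∨ σ = -1) (hβ0 : 0 ≤ β) (hβ : β ^ 2 ≤ M ^ 2 * η * w)
    (hd : (Module.finrank ℝ E : ℝ) * w ^ 2 = 1) :
    ∀ (k n : ℕ) (lam : ℝ), (k : ℝ) + n ≤ R → |lam - n * h ^ 2| ≤ 26 * M ^ 6 * n * η →
      ∫⁻ x, {x | GoodSeq σ c w δ β x}.indicator 1 x * ENNReal.ofReal (Real.exp (lam * pairSum x +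
          n * ∑ i, normPotential M h c (‖x i‖ ^ 2 - 1)))
          ∂(Measure.pi fun _ : Fin k => (stdGaussian E).map (w • ·)) ≤
        ENNReal.ofReal (q ^ k.choose 2 * Real.exp (-σ * h ^ 3 * w * (k.choose 3 + n * k.choose 2) +
          k * (stepConst M * (R ^ 2 * w * η)))) := by
  have hν : IsProbabilityMeasure ((stdGaussian E).map (w • ·)) :=
    Measure.isProbabilityMeasure_map (by fun_prop)
  intro k
  induction k with
  | zero =>
    intro n lam _ _
    refine (lintegral_mono (g := fun _ => 1) fun x => ?_).trans ?_
    · refine (mul_le_mul' (Set.indicator_le_self _ _ x) le_rfl).trans ?_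
      simp [pairSum]
    · simp
  | succ k ih =>
    intro n lam hkn hlam
    push_cast at hkn
    set ν := (stdGaussian E).map (w • ·)
    have hn0 : (0 : ℝ) ≤ n := Nat.cast_nonneg n
    have hk0 : (0 : ℝ) ≤ k := Nat.cast_nonneg k
    set lam' := nextTilt σ h w η lam with hlam'
    have hih := ih (n + 1) lam' (by push_cast; linarith)
      (abs_nextTilt_sub_le hr hσ (by linarith) hlam)
    set P := q ^ k * Real.exp (-σ * h ^ 3 * w * (n * k) + stepConst M * (R ^ 2 * w * η)) with hP
    have hP0 : 0 ≤ P := mul_nonneg (pow_nonneg hr.q_nonneg k) (Real.exp_pos _).le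
    rw [lintegral_pi_snoc ν (measurable_goodSeq_weight σ c w δ β M h lam n (k + 1))]
    have hinner : ∀ x : Fin k → E, ∫⁻ y, {x | GoodSeq σ c w δ β x}.indicator 1
          (Fin.snoc x y : Fin (k + 1) → E) * ENNReal.ofReal (Real.exp (lam *
          pairSum (Fin.snoc x y : Fin (k + 1) → E) + n * ∑ i, normPotential M h c
          (‖(Fin.snoc x y : Fin (k + 1) → E) i‖ ^ 2 - 1))) ∂ν ≤
        ENNReal.ofReal P * ({x | GoodSeq σ c w δ β x}.indicator 1 x * ENNReal.ofReal (Real.exp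
          (lam' * pairSum x + (n + 1 : ℕ) * ∑ i, normPotential M h c (‖x i‖ ^ 2 - 1)))) := by
      intro x
      by_cases hx : GoodSeq σ c w δ β x
      · have hstep := lintegral_step_le hr hσ hβ0 hβ hd (by linarith) hlam hx
        set B : Set E := {g : E | (∀ i, ⟪σ • x i, g⟫ ≤ -c * w) ∧ |‖g‖ ^ 2 - 1| ≤ δ} with hB
        set Z := lam * pairSum x + n * ∑ i, normPotential M h c (‖x i‖ ^ 2 - 1) with hZ
        have hpt : ∀ y : E, {x | GoodSeq σ c w δ β x}.indicator 1
            (Fin.snoc x y : Fin (k + 1) → E) * ENNReal.ofReal (Real.exp (lam *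
            pairSum (Fin.snoc x y : Fin (k + 1) → E) + n * ∑ i, normPotential M h c
            (‖(Fin.snoc x y : Fin (k + 1) → E) i‖ ^ 2 - 1))) ≤
            ENNReal.ofReal (Real.exp Z) * (ENNReal.ofReal (Real.exp (⟪lam • ∑ i, x i, y⟫ +
              n * normPotential M h c (‖y‖ ^ 2 - 1))) * B.indicator 1 y) := by
          intro y
          by_cases hy : (Fin.snoc x y : Fin (k + 1) → E) ∈ {x | GoodSeq σ c w δ β x}
          · have hyB : y ∈ B := (GoodSeq.of_snoc hy).2
            rw [Set.indicator_of_mem hy, Set.indicator_of_mem hyB, Pi.one_apply, Pi.one_apply,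
              one_mul, mul_one, ← ENNReal.ofReal_mul (Real.exp_pos _).le, ← Real.exp_add,
              pairSum_snoc]
            simp only [Fin.sum_univ_castSucc, Fin.snoc_castSucc, Fin.snoc_last]
            refine ENNReal.ofReal_le_ofReal (Real.exp_le_exp.2 (le_of_eq ?_))
            rw [hZ, real_inner_smul_left]
            ring
          · rw [Set.indicator_of_notMem hy, zero_mul]
            exact zero_le
        refine (lintegral_mono hpt).trans ?_
        rw [lintegral_const_mul' _ _ ENNReal.ofReal_ne_top]
        refine (mul_le_mul_right hstep _).trans_eq ?_
        rw [Set.indicator_of_mem (show x ∈ {x | GoodSeq σ c w δ β x} from hx), Pi.one_apply,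
          one_mul, ← ENNReal.ofReal_mul (Real.exp_pos _).le, ← ENNReal.ofReal_mul hP0, hP,
          mul_left_comm, ← Real.exp_add, mul_assoc (q ^ k), ← Real.exp_add]
        congr 3
        rw [hZ]
        push_cast
        ring
      · refine le_of_eq_of_le ?_ (zero_le (a := _))
        refine lintegral_eq_zero_of_ae_eq_zero (ae_of_all _ fun y => ?_)
        have hy : (Fin.snoc x y : Fin (k + 1) → E) ∉ {x | GoodSeq σ c w δ β x} :=
          fun hy => hx (GoodSeq.of_snoc hy).1
        simp only [Set.indicator_of_notMem hy, zero_mul, Pi.zero_apply]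
    refine (lintegral_mono hinner).trans ?_
    rw [lintegral_const_mul' _ _ ENNReal.ofReal_ne_top]
    refine (mul_le_mul_right hih _).trans_eq ?_
    rw [← ENNReal.ofReal_mul hP0, hP, mul_mul_mul_comm, ← Real.exp_add, ← pow_add]
    have e2 : (k + 1).choose 2 = k + k.choose 2 := by
      rw [Nat.choose_succ_succ' k 1, Nat.choose_one_right]
    have e3 : (k + 1).choose 3 = k.choose 2 + k.choose 3 := Nat.choose_succ_succ' k 2
    rw [e2, e3]
    congr 3
    push_cast
    ring

theorem measure_goodSeq_le {σ c w δ β M h η q : ℝ} {r : ℕ}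
    (hr : SmallRegime M h c w η δ q r)
    (hσ : σ = 1 ∨ σ = -1) (hβ0 : 0 ≤ β) (hβ : β ^ 2 ≤ M ^ 2 * η * w)
    (hd : (Module.finrank ℝ E : ℝ) * w ^ 2 = 1) :
    (Measure.pi fun _ : Fin r => (stdGaussian E).map (w • ·)) {x | GoodSeq σ c w δ β x} ≤
      ENNReal.ofReal (q ^ r.choose 2 * Real.exp (-σ * h ^ 3 * w * r.choose 3 +
        stepConst M * (r ^ 3 * w * η))) := by
  have h1 := lintegral_goodSeq_le (E := E) hr hσ hβ0 hβ hd r 0 0 (by simp) (by simp)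
  simp only [zero_mul, Nat.cast_zero, add_zero, Real.exp_zero, ENNReal.ofReal_one, mul_one] at h1
  rw [lintegral_indicator_one (measurableSet_goodSeq σ c w δ β r)] at h1
  refine h1.trans_eq ?_
  congr 3
  ring

end Induction

/-! ### The statement about perfect cliques -/

theorem multivariateGaussian_smul_one {d : ℕ} (w : ℝ) (hw : w ^ 2 = 1 / d) :
    multivariateGaussian (0 : EuclideanSpace ℝ (Fin d))
      ((1 / (d : ℝ)) • (1 : Matrix (Fin d) (Fin d) ℝ)) =
      (stdGaussian (EuclideanSpace ℝ (Fin d))).map (w • ·) := by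
  have hS : ((1 / (d : ℝ)) • (1 : Matrix (Fin d) (Fin d) ℝ)).PosSemidef :=
    Matrix.PosSemidef.one.smul (by positivity)
  have : IsProbabilityMeasure ((stdGaussian (EuclideanSpace ℝ (Fin d))).map (w • ·)) :=
    Measure.isProbabilityMeasure_map (by fun_prop)
  refine Measure.ext_of_charFun (funext fun t => ?_)
  rw [charFun_multivariateGaussian hS, charFun_map_smul, charFun_stdGaussian]
  congr 1
  have h1 : ‖w • t‖ ^ 2 = t.ofLp ⬝ᵥ ((1 / (d : ℝ)) • (1 : Matrix (Fin d) (Fin d) ℝ)).mulVec t := by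
    rw [norm_smul, mul_pow, Real.norm_eq_abs, sq_abs, hw, EuclideanSpace.real_norm_sq_eq,
      Matrix.smul_mulVec, Matrix.one_mulVec, dotProduct_smul, smul_eq_mul]
    congr 1
    simp only [dotProduct, sq]
  rw [← h1]
  simp
  ring

/-- Equality holds at r = 3. This converts the additive error r³ into a relative error of the main
term. -/
theorem cube_le_choose_three {r : ℕ} (hr : 3 ≤ r) : (r : ℝ) ^ 3 ≤ 27 * r.choose 3 := by
  obtain ⟨m, rfl⟩ := Nat.exists_eq_add_of_le' hr
  have h := Nat.descFactorial_eq_factorial_mul_choose (m + 3) 3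
  simp only [Nat.descFactorial, Nat.factorial] at h
  have h2 : 6 * (m + 3).choose 3 = (m + 1) * (m + 2) * (m + 3) := by
    have e1 : m + 3 - 2 = m + 1 := by omega
    have e2 : m + 3 - 1 = m + 2 := by omega
    have e3 : Nat.succ 2 * (Nat.succ 1 * (Nat.succ 0 * 1)) = 6 := rfl
    rw [e1, e2, e3, Nat.sub_zero, mul_one] at h
    rw [← h, mul_assoc]
  have h3 : (6 : ℝ) * (m + 3).choose 3 = (m + 1) * (m + 2) * (m + 3) := by exact_mod_cast h2
  have hm : (0 : ℝ) ≤ m := Nat.cast_nonneg m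
  push_cast
  nlinarith [mul_nonneg hm hm, mul_nonneg (mul_nonneg hm hm) hm]

theorem gaussianPDFReal_zero_one_threshold (p : ℝ) :
    gaussianPDFReal 0 1 (gaussThreshold p) = gaussDensityAtThreshold p := by
  rw [gaussianPDFReal_def, gaussDensityAtThreshold]
  simp
  ring

theorem gaussianPDFReal_zero_one_neg (x : ℝ) :
    gaussianPDFReal 0 1 (-x) = gaussianPDFReal 0 1 x := by
  simp [gaussianPDFReal_def]

theorem gaussThreshold_spec_compl {p : ℝ} (hp0 : 0 < p) (hp1 : p < 1) :
    (gaussianReal 0 1).real (Set.Iic (gaussThreshold p)) = 1 - p := by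
  have : NullSingletonClass (gaussianReal 0 1) := nullSingletonClass_gaussianReal one_ne_zero
  have h1 := gaussThreshold_spec hp0 hp1
  have h2 : (gaussianReal 0 1).map (fun x => -x) = gaussianReal 0 1 := by
    simpa using gaussianReal_map_neg (μ := 0) (v := 1)
  have h3 : (gaussianReal 0 1).real (Set.Iic (-gaussThreshold p)) =
      (gaussianReal 0 1).real (Set.Ioi (gaussThreshold p)) := by
    rw [← h2, map_measureReal_apply (by fun_prop) measurableSet_Iic, h2]
    have : (fun x : ℝ => -x) ⁻¹' Set.Iic (-gaussThreshold p) = Set.Ici (gaussThreshold p) := by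
      ext x; simp
    rw [this, measureReal_congr Ioi_ae_eq_Ici.symm]
  rw [h1, ← Set.compl_Iic, probReal_compl_eq_one_sub measurableSet_Iic] at h3
  linarith

theorem perfectAlpha_pos {C p : ℝ} (hC : 1 < C) (hp0 : 0 < p) (hp1 : p < 1) :
    0 < perfectAlpha C p := by
  have : 0 < Real.log (10 / p) := Real.log_pos (by rw [lt_div_iff₀ hp0]; linarith)
  unfold perfectAlpha
  positivity

theorem IsPerfectSeq.inner_sum_le {C p : ℝ} {ℓ d r : ℕ} {x : Fin r → EuclideanSpace ℝ (Fin d)}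
    (hx : IsPerfectSeq C p ℓ x) (i : Fin r) (a : Fin r → ℝ) :
    |⟪x i, ∑ j, (if j < i then a j else 0) • x j⟫| ≤
      perfectAlpha C p * √ℓ / √d * ‖∑ j, (if j < i then a j else 0) • x j‖ := by
  set v := ∑ j, (if j < i then a j else 0) • x j with hv
  have hmem : v ∈ Submodule.span ℝ (x '' {j | j < i}) := (mem_span_prefix_iff x i v).2 ⟨a, rfl⟩
  have h := inner_sub_prefixProj_of_mem x i hmem
  rw [inner_sub_left, sub_eq_zero] at h
  rw [h]
  exact (abs_real_inner_le_norm _ _).trans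
    (mul_le_mul_of_nonneg_right (hx i).2 (norm_nonneg _))

theorem IsPerfectSeq.goodSeq {C p σ c w M : ℝ} {ℓ d r : ℕ} {x : Fin r → EuclideanSpace ℝ (Fin d)}
    (hx : IsPerfectSeq C p ℓ x) (hw : 0 < w) (hd : (d : ℝ) = (w ^ 2)⁻¹) (hα : 0 ≤ perfectAlpha C p)
    (hαM : perfectAlpha C p ≤ M) (hMw : 3 * M * √w ≤ 1)
    (hclique : ∀ i j, i ≠ j → σ * ⟪x i, x j⟫ ≤ -c * w) :
    GoodSeq σ c w (3 * M * √w) (perfectAlpha C p * √ℓ / √d) x := by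
  refine ⟨hclique, fun i => ?_, fun i a => hx.inner_sum_le i a⟩
  -- As w = d^(-1/2), the factor d^(-1/4) is √w. The factor 3 in the window comes from |(1 ± t)² -
  -- 1| ≤ 3t for 0 ≤ t ≤ 1.
  have hδ : perfectDelta C p d = perfectAlpha C p * √w := by
    rw [perfectDelta, hd, Real.sqrt_eq_rpow, Real.inv_rpow (by positivity), ← Real.rpow_natCast,
      ← Real.rpow_mul hw.le, ← Real.rpow_neg hw.le]
    norm_num
  obtain ⟨h1, h2⟩ := (hx i).1
  rw [hδ] at h1 h2
  have h3 : perfectAlpha C p * √w ≤ M * √w := mul_le_mul_of_nonneg_right hαM (Real.sqrt_nonneg _)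
  have h4 : 0 ≤ perfectAlpha C p * √w := mul_nonneg hα (Real.sqrt_nonneg _)
  rw [abs_le]
  constructor <;> nlinarith [norm_nonneg (x i)]

theorem exists_perfect_clique_bound {C p σ c q h : ℝ} (hC : 1 < C) (hp0 : 0 < p) (hp1 : p < 1)
    (hσ : σ = 1 ∨ σ = -1) (hq : (gaussianReal 0 1).real (Set.Iic (-c)) = q)
    (hh : h = gaussianPDFReal 0 1 (-c) / q) :
    ∃ K : ℝ, 0 < K ∧ ∃ D₀ : ℝ, 0 < D₀ ∧ ∀ D : ℝ, D₀ ≤ D → ∃ ℓ₀ : ℕ, ∀ ℓ : ℕ, ℓ₀ ≤ ℓ →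
      ∀ d : ℕ, (d : ℝ) = D ^ 2 * (ℓ : ℝ) ^ 2 → ∀ r : ℕ, 1 ≤ r → (r : ℝ) ≤ C * (ℓ : ℝ) →
        (gaussSample d r).real {x | (∀ i j, i ≠ j → σ * ⟪x i, x j⟫ ≤ -c / √(d : ℝ)) ∧
          IsPerfectSeq C p ℓ x} ≤
        q ^ r.choose 2 * Real.exp (-σ * (h ^ 3 / √(d : ℝ)) * r.choose 3 +
          K * ((r : ℝ) ^ 3 / (D * √(d : ℝ)))) := by
  have hq0 : 0 < q := hq ▸ gaussianReal_real_Iic_pos _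
  have hh0 : 0 ≤ h := by
    rw [hh]
    exact div_nonneg (gaussianPDFReal_nonneg _ _ _) hq0.le
  have hα := perfectAlpha_pos hC hp0 hp1
  set α := perfectAlpha C p with hαdef
  set M : ℝ := 1 + h + |c| + C + α with hM
  have hc0 := abs_nonneg c
  have hM1 : 1 ≤ M := by linarith
  -- With η = 1/D, the lower bound on D is the condition 100 M⁶ η ≤ 1.
  refine ⟨stepConst M, by unfold stepConst; positivity, 100 * M ^ 6, by positivity, fun D hD => ?_⟩
  have hM6 : 1 ≤ M ^ 6 := one_le_pow₀ hM1
  have hD0 : 0 < D := by linarith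
  -- With w = 1/(Dℓ), the norm window 3M√w is at most η = 1/D exactly when ℓ ≥ 9M²D.
  refine ⟨⌈9 * M ^ 2 * D⌉₊ + 1, fun ℓ hℓ d hd r hr1 hrC => ?_⟩
  have hℓ1 : (9 * M ^ 2 * D) + 1 ≤ ℓ := by
    have h1 : ((⌈9 * M ^ 2 * D⌉₊ + 1 : ℕ) : ℝ) ≤ ℓ := by exact_mod_cast hℓ
    push_cast at h1
    linarith [Nat.le_ceil (9 * M ^ 2 * D)]
  have h9 : 0 ≤ 9 * M ^ 2 * D := by positivity
  have hℓ0 : 0 < (ℓ : ℝ) := by linarith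
  set η := D⁻¹ with hη
  have hη0 : 0 < η := inv_pos.2 hD0
  set w := (D * ℓ)⁻¹ with hw
  have hw0 : 0 < w := by positivity
  have hsq : √(d : ℝ) = w⁻¹ := by
    rw [hd, ← mul_pow, Real.sqrt_sq (by positivity), hw, inv_inv]
  have hdw : (d : ℝ) = (w ^ 2)⁻¹ := by
    rw [hd, hw]
    field_simp
  have hwη : w = η * (ℓ : ℝ)⁻¹ := by rw [hw, hη, mul_inv]
  have hlinv : (ℓ : ℝ)⁻¹ ≤ 1 := inv_le_one_of_one_le₀ (by linarith)
  have hδη : 3 * M * √w ≤ η := by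
    refine le_of_sq_le_sq ?_ hη0.le
    rw [mul_pow, Real.sq_sqrt hw0.le, hw, hη, inv_pow]
    have : (3 * M) ^ 2 * (D * ℓ)⁻¹ = 9 * M ^ 2 * D * (ℓ : ℝ)⁻¹ * (D ^ 2)⁻¹ := by
      field_simp
      ring
    rw [this]
    refine mul_le_of_le_one_left (by positivity) ?_
    rw [← div_eq_mul_inv, div_le_one hℓ0]
    linarith
  have hη1 : η ≤ 1 := by
    rw [hη]
    exact inv_le_one_of_one_le₀ (by linarith)
  have hreg : SmallRegime M h c w η (3 * M * √w) q r :=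
    { one_le_M := hM1
      h_nonneg := hh0
      h_le := by linarith
      c_le := by linarith
      w_pos := hw0
      w_le := by rw [hwη]; exact mul_le_of_le_one_right hη0.le hlinv
      δ_nonneg := by positivity
      δ_le := hδη
      δ_sq_le := by rw [mul_pow, Real.sq_sqrt hw0.le]; exact le_of_eq (by ring)
      η_le := by rw [hη, inv_mul_le_iff₀ hD0]; linarith
      one_le_R := by exact_mod_cast hr1
      R_mul_le := by
        calc (r : ℝ) * w ≤ C * ℓ * w := mul_le_mul_of_nonneg_right hrC hw0.le
          _ = C * η := by rw [hwη]; field_simp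
          _ ≤ M * η := mul_le_mul_of_nonneg_right (by linarith) hη0.le
      q_nonneg := hq0.le
      tangent := fun u => by
        have := gaussianReal_real_Iic_le_tangent (-c) u
        rwa [hq, ← hh] at this }
  have hβ : (α * √ℓ / √d) ^ 2 ≤ M ^ 2 * η * w := by
    -- Because ℓ w = η, the squared projection bound α² ℓ w² gains a factor η over w.
    have e : (α * √ℓ / √d) ^ 2 = α ^ 2 * η * w := by
      rw [hsq, div_pow, mul_pow, Real.sq_sqrt hℓ0.le, hwη]
      field_simp
    rw [e]
    have : α ^ 2 ≤ M ^ 2 := pow_le_pow_left₀ hα.le (by linarith) 2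
    gcongr
  have hdim : (Module.finrank ℝ (EuclideanSpace ℝ (Fin d)) : ℝ) * w ^ 2 = 1 := by
    rw [finrank_euclideanSpace_fin, hdw]
    field_simp
  have hmain := measure_goodSeq_le (E := EuclideanSpace ℝ (Fin d)) hreg hσ
    (β := α * √ℓ / √d) (by positivity) hβ hdim
  have hsub : {x : Fin r → EuclideanSpace ℝ (Fin d) |
      (∀ i j, i ≠ j → σ * ⟪x i, x j⟫ ≤ -c / √(d : ℝ)) ∧ IsPerfectSeq C p ℓ x} ⊆
      {x | GoodSeq σ c w (3 * M * √w) (α * √ℓ / √d) x} := by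
    intro x hx
    refine IsPerfectSeq.goodSeq hx.2 hw0 hdw hα.le (by linarith) (hδη.trans hη1) fun i j hij => ?_
    have := hx.1 i j hij
    rwa [hsq, div_inv_eq_mul] at this
  rw [gaussSample, multivariateGaussian_smul_one w (by rw [hdw]; simp), measureReal_def]
  refine ENNReal.toReal_le_of_le_ofReal (by positivity)
    (((measure_mono hsub).trans hmain).trans_eq ?_)
  congr 3
  rw [hsq, hη]
  field_simp

theorem proposition4 (C p : ℝ) (hC : 1 < C) (hp0 : 0 < p) (hp1 : p < 1) :
    ∃ K : ℝ, 0 < K ∧ ∃ D₀ : ℝ, 0 < D₀ ∧ ∀ D : ℝ, D₀ ≤ D → ∃ ℓ₀ : ℕ, ∀ ℓ : ℕ, ℓ₀ ≤ ℓ →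
      ∀ d : ℕ, (d : ℝ) = D ^ 2 * (ℓ : ℝ) ^ 2 → ∀ r : ℕ, 1 ≤ r → (r : ℝ) ≤ C * (ℓ : ℝ) →
        (r ≠ 2 →
          redPerfectProb C p ℓ d r ≤
            p ^ (r.choose 2) *
              Real.exp (-((1 - K / D) *
                (gaussDensityAtThreshold p ^ 3 / (p ^ 3 * √(d : ℝ))) * (r.choose 3 : ℝ))) ∧
          bluePerfectProb C p ℓ d r ≤
            (1 - p) ^ (r.choose 2) *
              Real.exp ((1 + K / D) *
                (gaussDensityAtThreshold p ^ 3 / ((1 - p) ^ 3 * √(d : ℝ))) * (r.choose 3 : ℝ))) ∧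
        (r = 2 →
          redPerfectProb C p ℓ d r ≤ p * Real.exp (K / (D * √(d : ℝ))) ∧
          bluePerfectProb C p ℓ d r ≤ (1 - p) * Real.exp (K / (D * √(d : ℝ)))) := by
  set c := gaussThreshold p with hc
  set a := gaussDensityAtThreshold p with ha
  have ha0 : 0 < a := by
    rw [ha, ← gaussianPDFReal_zero_one_threshold]
    exact gaussianPDFReal_pos _ _ _ one_ne_zero
  have hq0 : 0 < 1 - p := by linarith
  set hred := a / p with hhred
  set hblue := a / (1 - p) with hhblue
  have hred0 : 0 < hred := div_pos ha0 hp0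
  have hblue0 : 0 < hblue := div_pos ha0 hq0
  obtain ⟨K₁, hK₁, D₁, hD₁, H₁⟩ := exists_perfect_clique_bound (σ := 1) (h := hred) hC hp0 hp1
    (Or.inl rfl) (gaussThreshold_spec hp0 hp1)
    (by rw [gaussianPDFReal_zero_one_neg, gaussianPDFReal_zero_one_threshold])
  obtain ⟨K₂, hK₂, D₂, hD₂, H₂⟩ := exists_perfect_clique_bound (σ := -1) (c := -c) (q := 1 - p) (h := hblue)
    hC hp0 hp1 (Or.inr rfl) (by rw [neg_neg]; exact gaussThreshold_spec_compl hp0 hp1)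
    (by rw [neg_neg, gaussianPDFReal_zero_one_threshold])
  -- The first summand covers r = 2, where r³ = 8; the second covers r ≥ 3, where the error is
  -- compared with h³ C(r,3) at the price of 27/h³.
  set K := 8 * (K₁ + K₂) + 27 * (K₁ / hred ^ 3 + K₂ / hblue ^ 3) with hK
  have hk1 : 0 < K₁ / hred ^ 3 := by positivity
  have hk2 : 0 < K₂ / hblue ^ 3 := by positivity
  refine ⟨K, by positivity, max D₁ D₂, lt_max_of_lt_left hD₁, fun D hD => ?_⟩
  have hD0 : 0 < D := hD₁.trans_le ((le_max_left _ _).trans hD)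
  obtain ⟨ℓ₁, H₁⟩ := H₁ D ((le_max_left _ _).trans hD)
  obtain ⟨ℓ₂, H₂⟩ := H₂ D ((le_max_right _ _).trans hD)
  refine ⟨max (max ℓ₁ ℓ₂) 1, fun ℓ hℓ d hd r hr1 hrC => ?_⟩
  have hℓ1 : 1 ≤ ℓ := (le_max_right _ _).trans hℓ
  have hℓ12 : max ℓ₁ ℓ₂ ≤ ℓ := (le_max_left _ _).trans hℓ
  replace H₁ := H₁ ℓ ((le_max_left _ _).trans hℓ12) d hd r hr1 hrC
  replace H₂ := H₂ ℓ ((le_max_right _ _).trans hℓ12) d hd r hr1 hrC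
  have hℓpos : 0 < (ℓ : ℝ) := by exact_mod_cast hℓ1
  have hs : 0 < √(d : ℝ) := Real.sqrt_pos.2 (by rw [hd]; positivity)
  have hprob : IsProbabilityMeasure (gaussSample d r) := by
    unfold gaussSample
    infer_instance
  have hR : redPerfectProb C p ℓ d r ≤ (gaussSample d r).real
      {x | (∀ i j, i ≠ j → 1 * ⟪x i, x j⟫ ≤ -c / √(d : ℝ)) ∧ IsPerfectSeq C p ℓ x} := by
    refine measureReal_mono fun x hx => ⟨fun i j hij => ?_, hx.2⟩
    have h1 : ¬(geomGraph p x).Adj i j := hx.1 (Set.mem_univ i) (Set.mem_univ j) hij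
    rw [one_mul]
    by_contra h2
    exact h1 ⟨hij, (not_le.1 h2).le⟩
  have hB : bluePerfectProb C p ℓ d r ≤ (gaussSample d r).real
      {x | (∀ i j, i ≠ j → -1 * ⟪x i, x j⟫ ≤ - -c / √(d : ℝ)) ∧ IsPerfectSeq C p ℓ x} := by
    refine measureReal_mono fun x hx => ⟨fun i j hij => ?_, hx.2⟩
    have h1 : (geomGraph p x).Adj i j := hx.1 (Set.mem_univ i) (Set.mem_univ j) hij
    have h2 : -c / √(d : ℝ) ≤ ⟪x i, x j⟫ := h1.2
    rw [neg_div (√(d : ℝ)) (-c)]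
    linarith
  replace H₁ := hR.trans H₁
  replace H₂ := hB.trans H₂
  have e1 : hred ^ 3 / √(d : ℝ) = a ^ 3 / (p ^ 3 * √(d : ℝ)) := by
    rw [hhred, div_pow, div_div]
  have e2 : hblue ^ 3 / √(d : ℝ) = a ^ 3 / ((1 - p) ^ 3 * √(d : ℝ)) := by
    rw [hhblue, div_pow, div_div]
  rw [← e1, ← e2]
  refine ⟨fun hr2 => ?_, fun hr2 => ?_⟩
  -- For r = 1 both binomials vanish and the bound is the trivial one by 1, leaving no room for an
  -- additive error.
  · rcases (show r = 1 ∨ 3 ≤ r by omega) with rfl | hr3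
    · simp only [Nat.choose_eq_zero_of_lt (show 1 < 2 by norm_num),
        Nat.choose_eq_zero_of_lt (show 1 < 3 by norm_num), pow_zero, Nat.cast_zero, mul_zero,
        neg_zero, Real.exp_zero, mul_one]
      exact ⟨measureReal_le_one, measureReal_le_one⟩
    · have hcube := cube_le_choose_three hr3
      have key : ∀ k h : ℝ, 0 < k → 0 < h → 27 * (k / h ^ 3) ≤ K →
          k * ((r : ℝ) ^ 3 / (D * √(d : ℝ))) ≤ K / D * (h ^ 3 / √(d : ℝ)) * r.choose 3 := by
        intro k h hk hh hkK
        calc k * ((r : ℝ) ^ 3 / (D * √(d : ℝ))) ≤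
              k * ((27 * r.choose 3 : ℝ) / (D * √(d : ℝ))) := by gcongr
          _ = 27 * (k / h ^ 3) / D * (h ^ 3 / √(d : ℝ)) * r.choose 3 := by
              field_simp
          _ ≤ _ := by gcongr
      refine ⟨H₁.trans ?_, H₂.trans ?_⟩
      · refine mul_le_mul_of_nonneg_left (Real.exp_le_exp.2 ?_) (by positivity)
        linarith [key K₁ hred hK₁ hred0 (by linarith)]
      · refine mul_le_mul_of_nonneg_left (Real.exp_le_exp.2 ?_) (by positivity)
        linarith [key K₂ hblue hK₂ hblue0 (by linarith)]
  · subst hr2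
    have key : ∀ k : ℝ, 8 * k ≤ K → k * ((2 : ℕ) ^ 3 / (D * √(d : ℝ))) ≤ K / (D * √(d : ℝ)) := by
      intro k hk
      rw [← mul_div_assoc]
      push_cast
      gcongr
      linarith
    simp only [Nat.choose_self, Nat.choose_eq_zero_of_lt (show 2 < 3 by norm_num), pow_one,
      Nat.cast_zero, mul_zero, zero_add] at H₁ H₂
    exact ⟨H₁.trans (mul_le_mul_of_nonneg_left (Real.exp_le_exp.2 (key K₁ (by linarith))) hp0.le),
      H₂.trans (mul_le_mul_of_nonneg_left (Real.exp_le_exp.2 (key K₂ (by linarith))) hq0.le)⟩
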